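/- Let $q=p^f$ be a prime power, let $d\ge 3$ and $1\le k\le d/2$. Let $V$ be a $d$-dimensional vector space over $\mathbb{F}_{q^2}$ equipped with a non-degenerate Hermitian form $\kappa$ (with respect to the field automorphism $x\mapsto x^q$), let $\mathrm{PSU}_d(q)$ be the projective image of the group of linear isometries of $\kappa$ of determinant $1$, and let $\mathrm{P}\Gamma\mathrm{U}_d(q)=\mathrm{PGU}_d(q)\rtimes\mathrm{Aut}(\mathbb{F}_{q^2})$ be the group of all semisimilarities of $\kappa$, that is, semilinear bijections $g$ of $V$ with $\kappa(gv,gw)=c\,\kappa(v,w)^{\sigma}$ for some $c\ne 0$ and some $\sigma\in\mathrm{Aut}(\mathbb{F}_{q^2})$, modulo scalars. Let $G$ be any group with $\mathrm{PSU}_d(q)\le G\le \mathrm{P}\Gamma\mathrm{U}_d(q)$ (so that, if $(d,q)\neq(3,2)$, $G$ is an arbitrary almost simple group with socle $\mathrm{PSU}_d(q)$), and let $\Omega_k$ be the set of all totally singular $k$-dimensional subspaces of $V$, on which $G$ acts. A base for $G$ on $\Omega_k$ is a finite sequence $(\omega_1,\dots,\omega_\ell)$ in $\Omega_k$ whose pointwise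 stabilizer in $G$ is trivial; it is irredundant if $G>G_{\omega_1}>G_{\omega_1,\omega_2}>\cdots>G_{\omega_1,\dots,\omega_\ell}$. The action is IBIS if all irredundant bases have the same size, and $b(G)$ denotes the smallest size of a base. When $(d,q)\ne(3,2)$, the action of $G$ on $\Omega_k$ is not IBIS and $b(G)\ge 2$. When $(d,q)=(3,2)$ (so that $k=1$), the action of $G$ on $\Omega_1$ is IBIS. -/

import Mathlib

/-! ### Irredundant bases and IBIS actions -/

section Bases

variable (G : Type*) [Group G] {Ω : Type*} [MulAction G Ω]

/-- The pointwise stabilizer `G_{ω₁,…,ω_ℓ}` in `G` of the entries of a finite sequence. -/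
def seqStabilizer (l : List Ω) : Subgroup G :=
  ⨅ ω ∈ l, MulAction.stabilizer G ω

/-- A base: a finite sequence of points whose pointwise stabilizer is trivial. -/
def IsBaseSeq (l : List Ω) : Prop :=
  seqStabilizer G l = ⊥

/-- An irredundant sequence: `G > G_{ω₁} > G_{ω₁,ω₂} > ⋯ > G_{ω₁,…,ω_ℓ}`. -/
def IsIrredundantSeq (l : List Ω) : Prop :=
  ∀ i < l.length, seqStabilizer G (l.take (i + 1)) < seqStabilizer G (l.take i)

/-- An irredundant base: a base that is an irredundant sequence. -/
def IsIrredundantBase (l : List Ω) : Prop :=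
  IsBaseSeq G l ∧ IsIrredundantSeq G l

variable (Ω)

/-- The action of `G` on `Ω` is IBIS: all irredundant bases have the same size. -/
def IsIBIS : Prop :=
  ∀ l l' : List Ω, IsIrredundantBase G l → IsIrredundantBase G l' → l.length = l'.length

/-- The base size `b(G)`: the minimal cardinality of a base. -/
noncomputable def baseSize : ℕ :=
  sInf {n | ∃ l : List Ω, IsBaseSeq G l ∧ l.length = n}

end Bases

/-! ### Unitary groups and their action on totally singular subspaces

The form `B` below is conjugate-linear (with respect to `τ`) in the first variable and linear in the
second one. -/

section Unitary

variable {K V : Type*} [Field K] [AddCommGroup V] [Module K V] {τ : K →+* K}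

/-- `g` is a `σ`-semilinear bijection of `V` with `B (g v) (g w) = c · σ (B v w)`, where `c ≠ 0`. -/
structure IsSemisimilarity (B : V →ₛₗ[τ] V →ₗ[K] K) (g : Equiv.Perm V) (σ : K ≃+* K) (c : K) :
    Prop where
  map_add : ∀ v w, g (v + w) = g v + g w
  map_smul : ∀ (a : K) v, g (a • v) = σ a • g v
  ne_zero : c ≠ 0
  map_form : ∀ v w, B (g v) (g w) = c * σ (B v w)

/-- The group `ΓU(V, B)` of all semisimilarities of the form `B`. -/
def GammaU (B : V →ₛₗ[τ] V →ₗ[K] K) : Subgroup (Equiv.Perm V) where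
  carrier := {g | ∃ σ c, IsSemisimilarity B g σ c}
  one_mem' := ⟨RingEquiv.refl K, 1, by constructor <;> simp⟩
  mul_mem' := by
    rintro g h ⟨σ, c, hg⟩ ⟨ρ, e, hh⟩
    refine ⟨ρ.trans σ, c * σ e, ?_, ?_, ?_, ?_⟩
    · intro v w
      simp [hh.map_add, hg.map_add]
    · intro a v
      simp [hh.map_smul, hg.map_smul]
    · exact mul_ne_zero hg.ne_zero (by simpa using hh.ne_zero)
    · intro v w
      simp [hh.map_form, hg.map_form, mul_assoc]
  inv_mem' := by
    rintro g ⟨σ, c, hg⟩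
    refine ⟨σ.symm, σ.symm c⁻¹, ?_, ?_, ?_, ?_⟩
    · intro v w
      apply g.injective
      simp [hg.map_add]
    · intro a v
      apply g.injective
      simp [hg.map_smul]
    · simpa using hg.ne_zero
    · intro v w
      apply σ.injective
      have h := hg.map_form (g⁻¹ v) (g⁻¹ w)
      have hs : ∀ x, g (g⁻¹ x) = x := g.apply_symm_apply
      rw [hs, hs] at h
      simp [h, hg.ne_zero]

/-- The subgroup of `ΓU(V, B)` consisting of the scalar maps `v ↦ a v`. -/
def scalarSubgroup (B : V →ₛₗ[τ] V →ₗ[K] K) : Subgroup (GammaU B) where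
  carrier := {g | ∃ a : Kˣ, ∀ v, g.1 v = a • v}
  one_mem' := ⟨1, by simp⟩
  mul_mem' := by
    rintro g h ⟨a, ha⟩ ⟨b, hb⟩
    exact ⟨a * b, fun v => by simp [ha, hb, mul_smul]⟩
  inv_mem' := by
    rintro g ⟨a, ha⟩
    refine ⟨a⁻¹, fun v => ?_⟩
    apply g.1.injective
    rw [ha (a⁻¹ • v), smul_inv_smul]
    exact g.1.apply_symm_apply v

instance scalarSubgroup_normal (B : V →ₛₗ[τ] V →ₗ[K] K) : (scalarSubgroup B).Normal where
  conj_mem := by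
    rintro g ⟨a, ha⟩ ⟨h, σ, c, hh⟩
    refine ⟨Units.map (σ : K →* K) a, fun v => ?_⟩
    have h1 : h (g.1 (h⁻¹ v)) = σ (a : K) • v := by
      rw [ha, Units.smul_def, hh.map_smul]
      exact congrArg _ (h.apply_symm_apply v)
    simpa [Units.smul_def] using h1

/-- The projective group `PΓU(V, B)`: semisimilarities modulo scalars. -/
abbrev PGammaU (B : V →ₛₗ[τ] V →ₗ[K] K) : Type _ :=
  GammaU B ⧸ scalarSubgroup B

/-- The special unitary group `SU(V, B)`: the linear isometries of `B` with determinant one. -/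
def SpecialUnitary (B : V →ₛₗ[τ] V →ₗ[K] K) : Subgroup (V ≃ₗ[K] V) where
  carrier := {u | LinearMap.det (u : V →ₗ[K] V) = 1 ∧ ∀ v w, B (u v) (u w) = B v w}
  one_mem' := by
    refine ⟨?_, fun v w => rfl⟩
    have h : ((1 : V ≃ₗ[K] V) : V →ₗ[K] V) = LinearMap.id := rfl
    rw [h, LinearMap.det_id]
  mul_mem' := by
    rintro u u' ⟨h1, h2⟩ ⟨h1', h2'⟩
    refine ⟨?_, fun v w => by rw [LinearEquiv.mul_apply, LinearEquiv.mul_apply, h2, h2']⟩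
    have h : ((u * u' : V ≃ₗ[K] V) : V →ₗ[K] V) = (u : V →ₗ[K] V) * (u' : V →ₗ[K] V) := rfl
    rw [h, map_mul, h1, h1', one_mul]
  inv_mem' := by
    rintro u ⟨h1, h2⟩
    refine ⟨?_, fun v w => ?_⟩
    · have h : (u : V →ₗ[K] V) * ((u⁻¹ : V ≃ₗ[K] V) : V →ₗ[K] V) = LinearMap.id := by
        ext v
        exact u.apply_symm_apply v
      have h3 := congrArg LinearMap.det h
      rwa [map_mul, h1, one_mul, LinearMap.det_id] at h3
    · have h3 := h2 (u⁻¹ v) (u⁻¹ w)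
      have hs : ∀ x, u (u⁻¹ x) = x := u.apply_symm_apply
      rw [← h3, hs, hs]

/-- The inclusion of `SU(V, B)` into `ΓU(V, B)`. -/
def SpecialUnitary.toGammaU (B : V →ₛₗ[τ] V →ₗ[K] K) : SpecialUnitary B →* GammaU B where
  toFun u := ⟨u.1.toEquiv, RingEquiv.refl K, 1,
    ⟨fun v w => u.1.map_add v w, fun a v => u.1.map_smul a v, one_ne_zero, fun v w => by
      simpa using u.2.2 v w⟩⟩
  map_one' := rfl
  map_mul' _ _ := rfl

/-- `PSU(V, B)`, as a subgroup of `PΓU(V, B)`: the projective image of `SU(V, B)`. -/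
def PSU (B : V →ₛₗ[τ] V →ₗ[K] K) : Subgroup (PGammaU B) :=
  ((QuotientGroup.mk' (scalarSubgroup B)).comp (SpecialUnitary.toGammaU B)).range

/-- The set `Ω_k` of all `k`-dimensional totally singular subspaces of `V`. -/
def TotallySingular (B : V →ₛₗ[τ] V →ₗ[K] K) (k : ℕ) : Type _ :=
  {W : Submodule K V // Module.finrank K W = k ∧ ∀ v ∈ W, ∀ w ∈ W, B v w = 0}

/-- The image `g(W)` of a subspace `W` under a semisimilarity `g`. -/
def GammaU.image {B : V →ₛₗ[τ] V →ₗ[K] K} (g : GammaU B) (W : Submodule K V) :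
    Submodule K V where
  carrier := g.1 '' (W : Set V)
  zero_mem' := by
    obtain ⟨g, σ, c, hg⟩ := g
    refine ⟨0, W.zero_mem, ?_⟩
    simpa using hg.map_smul 0 0
  add_mem' := by
    obtain ⟨g, σ, c, hg⟩ := g
    rintro _ _ ⟨v, hv, rfl⟩ ⟨w, hw, rfl⟩
    exact ⟨v + w, W.add_mem hv hw, hg.map_add v w⟩
  smul_mem' := by
    obtain ⟨g, σ, c, hg⟩ := g
    rintro a _ ⟨v, hv, rfl⟩
    exact ⟨σ.symm a • v, W.smul_mem _ hv, by simp [hg.map_smul]⟩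

theorem GammaU.finrank_image {B : V →ₛₗ[τ] V →ₗ[K] K} (g : GammaU B) (W : Submodule K V) :
    Module.finrank K (GammaU.image g W) = Module.finrank K W := by
  obtain ⟨g, σ, c, hg⟩ := g
  let j : W ≃+ (GammaU.image (⟨g, σ, c, hg⟩ : GammaU B) W) :=
    { Equiv.Set.image g (W : Set V) g.injective with
      map_add' := fun v w => Subtype.ext (hg.map_add v.1 w.1) }
  exact (congrArg Cardinal.toNat
    (rank_eq_of_equiv_equiv σ j σ.bijective fun a v => Subtype.ext (hg.map_smul a v.1))).symm

/-- `ΓU(V, B)` acts on `Ω_k` by `g • W = g(W)`. -/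
instance (B : V →ₛₗ[τ] V →ₗ[K] K) (k : ℕ) : MulAction (GammaU B) (TotallySingular B k) where
  smul g W := ⟨GammaU.image g W.1, by
    refine ⟨(GammaU.finrank_image g W.1).trans W.2.1, ?_⟩
    obtain ⟨g, σ, c, hg⟩ := g
    rintro _ ⟨v, hv, rfl⟩ _ ⟨w, hw, rfl⟩
    simp [hg.map_form, W.2.2 v hv w hw]⟩
  one_smul W := Subtype.ext (SetLike.coe_injective (Set.image_id _))
  mul_smul g h W := Subtype.ext (SetLike.coe_injective (Set.image_comp g.1 h.1 _))

/-- `PΓU(V, B)` acts on `Ω_k`, because scalar maps fix every subspace. -/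
instance (B : V →ₛₗ[τ] V →ₗ[K] K) (k : ℕ) : MulAction (PGammaU B) (TotallySingular B k) :=
  MulAction.compHom _ (QuotientGroup.lift (scalarSubgroup B)
    (MulAction.toPermHom (GammaU B) (TotallySingular B k)) (by
      rintro g ⟨a, ha⟩
      refine Equiv.ext fun W => Subtype.ext (SetLike.coe_injective ?_)
      change g.1 '' (W.1 : Set V) = (W.1 : Set V)
      ext v
      constructor
      · rintro ⟨w, hw, rfl⟩
        rw [ha]
        exact W.1.smul_mem (a : K) hw
      · intro hv
        refine ⟨a⁻¹ • v, W.1.smul_mem ((a⁻¹ : Kˣ) : K) hv, ?_⟩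
        rw [ha, smul_inv_smul]))

/-- The class of `g` acts on `Ω_k` by `W ↦ g(W)`. -/
theorem PGammaU.coe_mk_smul (B : V →ₛₗ[τ] V →ₗ[K] K) (k : ℕ) (g : GammaU B)
    (W : TotallySingular B k) :
    (((QuotientGroup.mk g : PGammaU B) • W).1 : Set V) = g.1 '' (W.1 : Set V) := rfl

end Unitary

/-! ### Irredundant sequences and base size for an abstract action. -/

section BaseTheory

variable {G : Type*} [Group G] {Ω : Type*} [MulAction G Ω]

/-! Failure of IBIS is detected by two irredundant sequences of different lengths with the same
pointwise stabilizer: the action on Ω_k is faithful, so one list of further points, depending only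
on that stabilizer, completes both to irredundant bases (`exists_common_extension`,
`not_isIBIS_of_irredundantSeq`). All groups G are treated at once. Strict descents are witnessed by
elements of SU (transvections, Siegel elements, tori), which act through PSU ≤ G; equality of
stabilizers is checked for every semisimilarity.

In three cases the sequences are P, Q, M, C and P, Q, C, where M is determined by P, Q, C but not by
P, Q. For k = 1 and d ≥ 4, M is the point of a totally singular line PQ orthogonal to C
(`not_isIBIS_points_of_four_le`). For k = 1, d = 3 and q > 2, P = ⟨a⟩ and Q = ⟨b⟩ span a hyperbolic
line, C = ⟨a + zb + w⟩, and M = ⟨a + (z − τz)b⟩ lies on that line (`not_isIBIS_points_of_three_le`).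
For k ≥ 2 and q > 2, M is spanned by P ∩ Q and C ∩ (P + Q) (`not_isIBIS_of_exists_norm_ne_one`).

For k ≥ 2 and q = 2 all nonzero scalars have norm one, and the torus that moved M is lost. Instead,
modulo a common subspace E of dimension k − 2, one uses two opposite totally singular lines and
graphs of Hermitian 2 × 2 matrices between them: one configuration of five k-spaces and one of four
have the same stabilizer, the semisimilarities that preserve E and multiply the four frame vectors
by one scalar modulo E (`not_isIBIS_of_norm_eq_one`).

The bound b(G) ≥ 2 holds because a transvection centred in W fixes W.

For (d, q) = (3, 2), fixing two points of a hyperbolic line fixes its third singular point, and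
fixing one more point off the line leaves only scalars (`fixes_or_mem_scalarSubgroup`). So an
irredundant base has length 2 or 3 according to whether the stabilizer of its first two points is
trivial, and SU is transitive on ordered pairs of distinct singular points. -/

theorem mem_seqStabilizer {l : List Ω} {g : G} :
    g ∈ seqStabilizer G l ↔ ∀ ω ∈ l, g • ω = ω := by
  simp [seqStabilizer, Subgroup.mem_iInf, MulAction.mem_stabilizer_iff]

theorem seqStabilizer_append_singleton (l : List Ω) (ω : Ω) :
    seqStabilizer G (l ++ [ω]) = seqStabilizer G l ⊓ MulAction.stabilizer G ω := by
  ext g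
  simp only [mem_seqStabilizer, Subgroup.mem_inf, MulAction.mem_stabilizer_iff, List.mem_append,
    List.mem_singleton]
  constructor
  · exact fun h => ⟨fun x hx => h x (Or.inl hx), h ω (Or.inr rfl)⟩
  · rintro ⟨h, h'⟩ x (hx | rfl)
    exacts [h x hx, h']

theorem IsIrredundantSeq.nil : IsIrredundantSeq G ([] : List Ω) := by
  intro i hi
  simp at hi

theorem IsIrredundantSeq.append_singleton {l : List Ω} (hl : IsIrredundantSeq G l) {ω : Ω}
    (h : ∃ g : G, (∀ x ∈ l, g • x = x) ∧ g • ω ≠ ω) : IsIrredundantSeq G (l ++ [ω]) := by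
  intro i hi
  rw [List.length_append, List.length_singleton] at hi
  rcases Nat.lt_or_ge i l.length with h' | h'
  · rw [List.take_append_of_le_length h', List.take_append_of_le_length h'.le]
    exact hl i h'
  · obtain rfl : i = l.length := by omega
    rw [List.take_of_length_le (by simp), List.take_left, seqStabilizer_append_singleton]
    refine lt_of_le_of_ne inf_le_left fun he => ?_
    obtain ⟨g, hg, hω⟩ := h
    have : g ∈ seqStabilizer G l := mem_seqStabilizer.2 hg
    rw [← he] at this
    exact hω this.2

/-- A subgroup of a finite group acting faithfully admits an irredundant sequence of points
cutting it down to the trivial group. -/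
theorem exists_common_extension [Finite G]
    (hfaith : ∀ g : G, (∀ ω : Ω, g • ω = ω) → g = 1) (S : Subgroup G) :
    ∃ r : List Ω, ∀ l : List Ω, IsIrredundantSeq G l → seqStabilizer G l = S →
      IsIrredundantBase G (l ++ r) := by
  induction S using WellFoundedLT.induction with
  | ind S ih =>
    by_cases hS : S = ⊥
    · exact ⟨[], fun l hl hlS => by rw [List.append_nil]; exact ⟨hlS.trans hS, hl⟩⟩
    · obtain ⟨g, hgS, hg⟩ := S.ne_bot_iff_exists_ne_one.1 hS |>.elim
        fun g hg => (⟨g.1, g.2, fun h => hg (Subtype.ext h)⟩ : ∃ g ∈ S, g ≠ 1)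
      obtain ⟨ω, hω⟩ : ∃ ω : Ω, g • ω ≠ ω := by
        by_contra! h
        exact hg (hfaith g h)
      obtain ⟨r, hr⟩ := ih (S ⊓ MulAction.stabilizer G ω)
        (lt_of_le_of_ne inf_le_left fun he => hω (by rw [← he] at hgS; exact hgS.2))
      refine ⟨ω :: r, fun l hl hlS => ?_⟩
      rw [show l ++ ω :: r = (l ++ [ω]) ++ r by simp]
      refine hr _ (hl.append_singleton ⟨g, ?_, hω⟩) ?_
      · rw [← mem_seqStabilizer, hlS]
        exact hgS
      · rw [seqStabilizer_append_singleton, hlS]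

/-- The completing list depends on the common stabilizer alone, so the same points are appended to
both sequences and the difference in length survives. -/
theorem not_isIBIS_of_irredundantSeq [Finite G]
    (hfaith : ∀ g : G, (∀ ω : Ω, g • ω = ω) → g = 1) {l l' : List Ω}
    (hl : IsIrredundantSeq G l) (hl' : IsIrredundantSeq G l')
    (h : seqStabilizer G l = seqStabilizer G l') (hlen : l.length ≠ l'.length) :
    ¬ IsIBIS G Ω := by
  intro hI
  obtain ⟨r, hr⟩ := exists_common_extension hfaith (seqStabilizer G l)
  have := hI _ _ (hr l hl rfl) (hr l' hl' h.symm)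
  simp only [List.length_append] at this
  omega

theorem two_le_baseSize [Finite Ω]
    (hfaith : ∀ g : G, (∀ ω : Ω, g • ω = ω) → g = 1)
    (hnil : ∃ g : G, g ≠ 1) (hone : ∀ ω : Ω, ∃ g : G, g ≠ 1 ∧ g • ω = ω) :
    2 ≤ baseSize G Ω := by
  have := Fintype.ofFinite Ω
  -- The list of all points is a base by faithfulness; without some base the infimum would be the
  -- default value 0.
  refine le_csInf ⟨_, (Finset.univ : Finset Ω).toList, ?_, rfl⟩ ?_
  · refine (Subgroup.eq_bot_iff_forall _).2 fun g hg => hfaith g fun ω => ?_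
    exact mem_seqStabilizer.1 hg ω (by simp)
  · rintro n ⟨l, hl, rfl⟩
    match l, hl with
    | [], hl =>
      obtain ⟨g, hg⟩ := hnil
      exact absurd ((Subgroup.eq_bot_iff_forall _).1 hl g (mem_seqStabilizer.2 (by simp))) hg
    | [ω], hl =>
      obtain ⟨g, hg, hω⟩ := hone ω
      exact absurd ((Subgroup.eq_bot_iff_forall _).1 hl g (mem_seqStabilizer.2 (by simpa))) hg
    | _ :: _ :: _, _ => simp

end BaseTheory

/-! ### The involution of the field with q² elements. -/

/-- The properties of the involution `x ↦ x ^ q` of the field with `q ^ 2` elements. -/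
structure IsFiniteConj {K : Type*} [Field K] (τ : K →+* K) : Prop where
  invol : ∀ x, τ (τ x) = x
  norm_surj : ∀ x, τ x = x → ∃ y, τ y * y = x
  trace_ne : ∃ t, t + τ t ≠ 0
  moved : ∃ s, τ s ≠ s

namespace IsFiniteConj

variable {K : Type*} [Field K] {τ : K →+* K}

/-- Fixed elements form a field over which the trace is linear, so one nonzero trace can be rescaled
to any fixed element. -/
theorem trace_surj (h : IsFiniteConj τ) {x : K} (hx : τ x = x) : ∃ t, t + τ t = x := by
  obtain ⟨t, ht⟩ := h.trace_ne
  refine ⟨x / (t + τ t) * t, ?_⟩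
  have h1 : τ (t + τ t) = t + τ t := by rw [map_add, h.invol, add_comm]
  rw [map_mul, map_div₀, h1, hx]
  field_simp

theorem exists_skew (h : IsFiniteConj τ) : ∃ t, t ≠ 0 ∧ τ t = -t := by
  obtain ⟨s, hs⟩ := h.moved
  exact ⟨s - τ s, sub_ne_zero.2 (Ne.symm hs), by rw [map_sub, h.invol, neg_sub]⟩

/-- If a moved z has trace zero, then the characteristic is odd (otherwise τ z = -z = z), and z + 1
has trace 2 ≠ 0. -/
theorem exists_generic (h : IsFiniteConj τ) : ∃ z, τ z ≠ z ∧ z + τ z ≠ 0 := by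
  obtain ⟨z, hz⟩ := h.moved
  by_cases h0 : z + τ z = 0
  · have hτ : τ z = -z := by linear_combination h0
    refine ⟨z + 1, ?_, ?_⟩
    · simpa using hz
    · rw [map_add, map_one, hτ]
      intro h2
      apply hz
      rw [hτ]
      linear_combination z * h2 * (-1)
  · exact ⟨z, hz, h0⟩

end IsFiniteConj

/-- Norms: in the cyclic group of order (q + 1)(q - 1), a power gⁿ killed by q - 1 has q + 1
dividing n, hence is the norm of a power of g. Trace and non-triviality: X^q + X and X^q - X have
degree q < q², so neither vanishes on the whole field. -/
theorem isFiniteConj_iterateFrobenius {K : Type*} [Field K] [Finite K] (p f : ℕ) [Fact p.Prime]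
    [CharP K p] (hK : Nat.card K = (p ^ f) ^ 2) : IsFiniteConj (iterateFrobenius K p f) := by
  have := Fintype.ofFinite K
  have hq : 1 < p ^ f := by
    have h1 : 1 < Nat.card K := Finite.one_lt_card
    rw [hK] at h1
    by_contra! h2
    interval_cases p ^ f <;> omega
  have hcard : Fintype.card K = (p ^ f) ^ 2 := by rw [← Nat.card_eq_fintype_card, hK]
  have hpow : ∀ x : K, x ^ (p ^ f * p ^ f) = x := fun x => by
    rw [← sq, ← hcard, FiniteField.pow_card]
  refine ⟨fun x => ?_, fun x hx => ?_, ?_, ?_⟩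
  · rw [iterateFrobenius_def, iterateFrobenius_def, ← pow_mul, hpow]
  · by_cases hx0 : x = 0
    · exact ⟨0, by simp [hx0]⟩
    obtain ⟨g, hg⟩ := IsCyclic.exists_generator (α := Kˣ)
    obtain ⟨n, hn⟩ := (mem_powers_iff_mem_zpowers.2 (hg (Units.mk0 x hx0)))
    simp only at hn
    have horder : orderOf g = (p ^ f) ^ 2 - 1 := by
      rw [orderOf_eq_card_of_forall_mem_zpowers hg, Nat.card_units, hK]
    rw [iterateFrobenius_def] at hx
    set q := p ^ f with hqdef
    have h1 : (Units.mk0 x hx0) ^ (q - 1) = 1 := by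
      ext
      have : x ^ (q - 1) * x = 1 * x := by
        rw [← pow_succ, Nat.sub_add_cancel hq.le, hx, one_mul]
      simpa using mul_right_cancel₀ hx0 this
    rw [← hn, ← pow_mul] at h1
    have h2 := orderOf_dvd_of_pow_eq_one h1
    rw [horder, show q ^ 2 - 1 = (q + 1) * (q - 1) by
      rw [← Nat.sq_sub_sq, one_pow]] at h2
    have h3 := Nat.dvd_of_mul_dvd_mul_right (by omega) h2
    obtain ⟨m, rfl⟩ := h3
    refine ⟨((g ^ m : Kˣ) : K), ?_⟩
    rw [iterateFrobenius_def, ← pow_succ, ← Units.val_pow_eq_pow_val, ← pow_mul, mul_comm m, hn]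
    rfl
  · by_contra! h
    have h1 : (Polynomial.X ^ (p ^ f) + Polynomial.X : Polynomial K) = 0 := by
      apply Polynomial.eq_zero_of_natDegree_lt_card_of_eval_eq_zero' _ Finset.univ
      · intro x _
        simpa [iterateFrobenius_def, add_comm] using h x
      · rw [Polynomial.natDegree_add_eq_left_of_natDegree_lt (by simpa using hq)]
        simp only [Polynomial.natDegree_X_pow, Finset.card_univ, hcard]
        nlinarith
    have := congrArg (Polynomial.coeff · 1) h1
    simp [Polynomial.coeff_X_pow, hq.ne] at this
  · by_contra! h
    have h1 : (Polynomial.X ^ (p ^ f) - Polynomial.X : Polynomial K) = 0 := by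
      apply Polynomial.eq_zero_of_natDegree_lt_card_of_eval_eq_zero' _ Finset.univ
      · intro x _
        simpa [iterateFrobenius_def, sub_eq_zero] using h x
      · rw [Polynomial.natDegree_sub_eq_left_of_natDegree_lt (by simpa using hq)]
        simp only [Polynomial.natDegree_X_pow, Finset.card_univ, hcard]
        nlinarith
    have := congrArg (Polynomial.coeff · 1) h1
    simp [Polynomial.coeff_X_pow, hq.ne] at this

/-- If the field with `q ^ 2` elements has `q > 2`, it has an element of norm one and order
greater than `3`. -/
theorem exists_norm_one_cube_ne {K : Type*} [Field K] [Finite K] (p f : ℕ) [Fact p.Prime]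
    [CharP K p] (hK : Nat.card K = (p ^ f) ^ 2) (hq : 2 < p ^ f) :
    ∃ x : K, iterateFrobenius K p f x * x = 1 ∧ x ^ 3 ≠ 1 := by
  obtain ⟨g, hg⟩ := IsCyclic.exists_generator (α := Kˣ)
  have horder : orderOf g = (p ^ f) ^ 2 - 1 := by
    rw [orderOf_eq_card_of_forall_mem_zpowers hg, Nat.card_units, hK]
  set q := p ^ f with hqdef
  have hfac : q ^ 2 - 1 = (q + 1) * (q - 1) := by rw [← Nat.sq_sub_sq, one_pow]
  rw [hfac] at horder
  -- The element g^(q-1) has norm g^(q²-1) = 1 and order q + 1 > 3.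
  refine ⟨((g ^ (q - 1) : Kˣ) : K), ?_, ?_⟩
  · rw [iterateFrobenius_def, ← pow_succ, ← Units.val_pow_eq_pow_val, ← pow_mul,
      mul_comm, ← horder, pow_orderOf_eq_one, Units.val_one]
  · intro h
    rw [← Units.val_pow_eq_pow_val, Units.val_eq_one, ← pow_mul] at h
    have h2 := Nat.le_of_dvd (by omega) (orderOf_dvd_of_pow_eq_one h)
    rw [horder, mul_comm] at h2
    have := Nat.le_of_mul_le_mul_left h2 (by omega)
    omega

/-- If the field with `q ^ 2` elements has `q > 2`, it has a nonzero element of norm not one. -/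
theorem exists_norm_ne_one {K : Type*} [Field K] [Finite K] (p f : ℕ) [Fact p.Prime]
    [CharP K p] (hK : Nat.card K = (p ^ f) ^ 2) (hq : 2 < p ^ f) :
    ∃ x : K, x ≠ 0 ∧ iterateFrobenius K p f x * x ≠ 1 := by
  obtain ⟨g, hg⟩ := IsCyclic.exists_generator (α := Kˣ)
  have horder : orderOf g = (p ^ f) ^ 2 - 1 := by
    rw [orderOf_eq_card_of_forall_mem_zpowers hg, Nat.card_units, hK]
  set q := p ^ f with hqdef
  have hfac : q ^ 2 - 1 = (q + 1) * (q - 1) := by rw [← Nat.sq_sub_sq, one_pow]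
  rw [hfac] at horder
  -- The norm of g is g^(q+1), and q + 1 is smaller than the order q² - 1 of g.
  refine ⟨g, g.ne_zero, ?_⟩
  intro h
  rw [iterateFrobenius_def, ← pow_succ, ← Units.val_pow_eq_pow_val, Units.val_eq_one] at h
  have h2 := Nat.le_of_dvd (by omega) (orderOf_dvd_of_pow_eq_one h)
  rw [horder] at h2
  have := Nat.le_of_mul_le_mul_left (h2.trans_eq (mul_one _).symm) (by omega)
  omega

/-! ### Explicit elements of the special unitary group. -/

section SpecialElements

variable {K V : Type*} [Field K] [AddCommGroup V] [Module K V] {τ : K →+* K}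
  {B : V →ₛₗ[τ] V →ₗ[K] K}

/-- `g` maps the subspace `W` into itself. -/
def GammaU.Fixes (g : GammaU B) (W : Submodule K V) : Prop :=
  ∀ v ∈ W, g.1 v ∈ W

/-- An injective map of a finite set into itself is onto, so invariance under g can be tested by
inclusion. -/
theorem smul_eq_self_iff [Finite V] {k : ℕ} (g : GammaU B) (W : TotallySingular B k) :
    (QuotientGroup.mk g : PGammaU B) • W = W ↔ GammaU.Fixes g W.1 := by
  have h1 : (QuotientGroup.mk g : PGammaU B) • W = W ↔ g.1 '' (W.1 : Set V) = W.1 := by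
    rw [← PGammaU.coe_mk_smul, SetLike.coe_set_eq]
    exact ⟨fun h => congrArg _ h, fun h => Subtype.ext h⟩
  rw [h1]
  constructor
  · intro h v hv
    have : g.1 v ∈ g.1 '' (W.1 : Set V) := ⟨v, hv, rfl⟩
    rwa [h] at this
  · intro h
    refine Set.eq_of_subset_of_ncard_le ?_ ?_ (Set.toFinite _)
    · rintro _ ⟨v, hv, rfl⟩
      exact h v hv
    · rw [Set.ncard_image_of_injective _ g.1.injective]

theorem PSU_mk_mem (u : SpecialUnitary B) :
    (QuotientGroup.mk (SpecialUnitary.toGammaU B u) : PGammaU B) ∈ PSU B :=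
  ⟨u, rfl⟩

/-- Every strict descent is certified by an element of SU, which is available in each G containing
PSU. -/
theorem irredundantSeq_append_singleton_of_specialUnitary [Finite V] {k : ℕ}
    {G : Subgroup (PGammaU B)} (hG : PSU B ≤ G) {l : List (TotallySingular B k)}
    (hl : IsIrredundantSeq G l) {W : TotallySingular B k} (u : SpecialUnitary B)
    (hfix : ∀ X ∈ l, ∀ v ∈ X.1, u.1 v ∈ X.1) (hmove : ∃ v ∈ W.1, u.1 v ∉ W.1) :
    IsIrredundantSeq G (l ++ [W]) := by
  refine hl.append_singleton ⟨⟨_, hG (PSU_mk_mem u)⟩, fun X hX => ?_, fun h => ?_⟩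
  · rw [Subgroup.smul_def, smul_eq_self_iff]
    exact hfix X hX
  · rw [Subgroup.smul_def, smul_eq_self_iff] at h
    obtain ⟨v, hv, hv'⟩ := hmove
    exact hv' (h v hv)

theorem seqStabilizer_eq_of_fixes [Finite V] {k : ℕ} (G : Subgroup (PGammaU B))
    {l l' : List (TotallySingular B k)}
    (h : ∀ g : GammaU B, (∀ X ∈ l, GammaU.Fixes g X.1) ↔ (∀ X ∈ l', GammaU.Fixes g X.1)) :
    seqStabilizer G l = seqStabilizer G l' := by
  ext ⟨g, hg⟩
  obtain ⟨g, rfl⟩ := QuotientGroup.mk_surjective g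
  simp only [mem_seqStabilizer, Subgroup.smul_def, smul_eq_self_iff]
  exact h g

variable (B) in
/-- `φ` is a linear isometry of `B` of determinant `δ`. -/
structure IsIsometryDet (φ : V →ₗ[K] V) (δ : K) : Prop where
  isom : ∀ v w, B (φ v) (φ w) = B v w
  det_eq : LinearMap.det φ = δ

theorem IsIsometryDet.comp {φ ψ : V →ₗ[K] V} {δ ε : K} (h : IsIsometryDet B φ δ)
    (h' : IsIsometryDet B ψ ε) : IsIsometryDet B (φ ∘ₗ ψ) (δ * ε) where
  isom v w := by simp [h.isom, h'.isom]
  det_eq := by rw [LinearMap.det_comp, h.det_eq, h'.det_eq]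

theorem IsIsometryDet.exists_specialUnitary [FiniteDimensional K V] {φ : V →ₗ[K] V} {δ : K}
    (h : IsIsometryDet B φ δ) (hδ : δ = 1) :
    ∃ u : SpecialUnitary B, ∀ v, u.1 v = φ v := by
  have hdet : LinearMap.det φ = 1 := h.det_eq.trans hδ
  let e : V ≃ₗ[K] V := LinearMap.equivOfDetNeZero φ (by simp [hdet])
  have he : ∀ v, e v = φ v := fun v => rfl
  refine ⟨⟨e, ?_, fun v w => ?_⟩, he⟩
  · rw [← hdet]
    congr 1
  · rw [he, he, h.isom]

open LinearMap (transvection) in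
/-- The two-parameter family containing hyperbolic tori and long root elements. -/
theorem isIsometryDet_pair [FiniteDimensional K V] (hτ : ∀ x, τ (τ x) = x) (hB : B.IsSymm)
    {e f : V} (he : B e e = 0) (hf : B f f = 0) (hef : B e f = 1) {x : K} (hx : x ≠ 0) :
    IsIsometryDet B (transvection ((x - 1) • B f) e ∘ₗ transvection (((τ x)⁻¹ - 1) • B e) f)
      (x * (τ x)⁻¹) where
  isom v w := by
    have hfe : B f e = 1 := by rw [← hB.eq, hef, map_one]
    have hve := hB.eq e v
    have hvf := hB.eq f v
    have hτx : τ x ≠ 0 := by simpa using hx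
    simp only [LinearMap.comp_apply, transvection.apply, LinearMap.smul_apply, map_add,
      map_smul, map_smulₛₗ, LinearMap.add_apply, smul_eq_mul, he, hf, hef, hfe, ← hve, ← hvf,
      map_mul, map_sub, map_one, map_zero, map_inv₀, hτ, mul_zero, add_zero, mul_one]
    field_simp
    ring
  -- Here `transvection φ u` is v ↦ v + φ(v)u without the condition φ(u) = 0, so its determinant is
  -- 1 + φ(u). The two factors contribute x and (τ x)⁻¹.
  det_eq := by
    have hfe : B f e = 1 := by rw [← hB.eq, hef, map_one]
    rw [LinearMap.det_comp, transvection.det, transvection.det]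
    simp [hef, hfe]

-- The map multiplies w by x and is the identity on the complement of w. It serves to correct
-- determinants.
open LinearMap (transvection) in
theorem isIsometryDet_reflection [FiniteDimensional K V] (hB : B.IsSymm)
    {w : V} (hw : B w w ≠ 0) {x : K} (hx : τ x * x = 1) :
    IsIsometryDet B (transvection (((x - 1) * (B w w)⁻¹) • B w) w) x where
  isom u v := by
    have hu := hB.eq w u
    have hww := hB.eq w w
    simp only [transvection.apply, LinearMap.smul_apply, map_add,
      map_smul, map_smulₛₗ, LinearMap.add_apply, smul_eq_mul, ← hu,
      map_mul, map_sub, map_one, map_inv₀, hww]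
    field_simp
    linear_combination (τ (B w u)) * B w v * hx
  det_eq := by
    rw [transvection.det]
    simp [hw]

-- The cross terms in the form are multiples of t + τ t, which vanishes, and the quadratic term
-- vanishes because u is singular.
open LinearMap (transvection) in
theorem exists_specialUnitary_transvection [FiniteDimensional K V] (hB : B.IsSymm)
    {u : V} (hu : B u u = 0) {t : K} (ht : τ t = -t) :
    ∃ g : SpecialUnitary B, ∀ v, g.1 v = v + (t * B u v) • u := by
  have h : IsIsometryDet B (transvection (t • B u) u) 1 := by
    constructor
    · intro v w
      have hv := hB.eq u v
      simp only [transvection.apply, LinearMap.smul_apply, map_add, map_smul, map_smulₛₗ,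
        LinearMap.add_apply, smul_eq_mul, ← hv, map_mul, ht, hu]
      ring
    · rw [transvection.det]
      simp [hu]
  obtain ⟨g, hg⟩ := h.exists_specialUnitary rfl
  exact ⟨g, fun v => by simp [hg, transvection.apply]⟩

-- This is a Siegel transformation: for u and w orthogonal and singular, the two rank-one changes
-- compensate each other in the form. These elements act unipotently on a pair of opposite totally
-- singular lines.
open LinearMap (transvection) in
theorem exists_specialUnitary_siegel [FiniteDimensional K V] (hτ : ∀ x, τ (τ x) = x)
    (hB : B.IsSymm) {u w : V} (hu : B u u = 0) (hw : B w w = 0) (huw : B u w = 0) (x : K) :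
    ∃ g : SpecialUnitary B, ∀ v, g.1 v = v + (x * B w v) • u - (τ x * B u v) • w := by
  have hwu : B w u = 0 := by rw [← hB.eq, huw, map_zero]
  have h : IsIsometryDet B (transvection (-τ x • B u) w ∘ₗ transvection (x • B w) u) 1 := by
    constructor
    · intro v z
      have hv := hB.eq u v
      have hv' := hB.eq w v
      simp only [LinearMap.comp_apply, transvection.apply, LinearMap.smul_apply, map_add, map_smul,
        map_smulₛₗ, LinearMap.add_apply, smul_eq_mul, ← hv, ← hv', map_mul, map_neg, hτ, hu, hw,
        huw, hwu, mul_zero, add_zero, map_zero]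
      ring
    · rw [LinearMap.det_comp, transvection.det, transvection.det]
      simp [huw, hwu]
  obtain ⟨g, hg⟩ := h.exists_specialUnitary rfl
  refine ⟨g, fun v => ?_⟩
  simp [hg, transvection.apply, hu, sub_eq_add_neg]

-- The torus on the hyperbolic plane of e and f has determinant x(τ x)⁻¹; the reflection in w by the
-- inverse factor, of norm one, brings it back to 1.
open LinearMap (transvection) in
theorem exists_specialUnitary_torus [FiniteDimensional K V] (hτ : ∀ x, τ (τ x) = x)
    (hB : B.IsSymm) {e f w : V} (he : B e e = 0) (hf : B f f = 0) (hef : B e f = 1)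
    (hw : B w w ≠ 0) (hew : B e w = 0) (hfw : B f w = 0) {x : K} (hx : x ≠ 0) :
    ∃ g : SpecialUnitary B, g.1 e = x • e ∧ g.1 f = (τ x)⁻¹ • f ∧ g.1 w = (τ x * x⁻¹) • w := by
  have hfe : B f e = 1 := by rw [← hB.eq, hef, map_one]
  have hwe : B w e = 0 := by rw [← hB.eq, hew, map_zero]
  have hwf : B w f = 0 := by rw [← hB.eq, hfw, map_zero]
  have hτx : τ x ≠ 0 := by simpa using hx
  obtain ⟨g, hg⟩ := IsIsometryDet.exists_specialUnitary
    ((isIsometryDet_reflection hB hw (x := τ x * x⁻¹) (by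
      rw [map_mul, map_inv₀, hτ]; field_simp)).comp
    (isIsometryDet_pair hτ hB he hf hef hx)) (by field_simp)
  refine ⟨g, ?_, ?_, ?_⟩ <;>
    simp only [hg, LinearMap.comp_apply, transvection.apply, LinearMap.smul_apply, map_add,
      map_smul, he, hf, hef, hfe, hew, hfw, hwe, hwf, smul_eq_mul, mul_zero, mul_one, zero_smul,
      add_zero]
  · module
  · module
  · rw [mul_assoc, inv_mul_cancel₀ hw]
    module

-- Using x on one hyperbolic pair and x⁻¹ on the other makes the two determinants cancel.
open LinearMap (transvection) in
theorem exists_specialUnitary_torus_pair [FiniteDimensional K V] (hτ : ∀ x, τ (τ x) = x)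
    (hB : B.IsSymm) {e f e' f' : V} (he : B e e = 0) (hf : B f f = 0) (hef : B e f = 1)
    (he' : B e' e' = 0) (hf' : B f' f' = 0) (hef' : B e' f' = 1)
    (h1 : B e e' = 0) (h2 : B e f' = 0) (h3 : B f e' = 0) (h4 : B f f' = 0)
    {x : K} (hx : x ≠ 0) :
    ∃ g : SpecialUnitary B, g.1 e = x • e ∧ g.1 f = (τ x)⁻¹ • f ∧ g.1 e' = x⁻¹ • e' ∧
      g.1 f' = τ x • f' ∧
      ∀ v, B e v = 0 → B f v = 0 → B e' v = 0 → B f' v = 0 → g.1 v = v := by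
  have hfe : B f e = 1 := by rw [← hB.eq, hef, map_one]
  have hfe' : B f' e' = 1 := by rw [← hB.eq, hef', map_one]
  have h1' : B e' e = 0 := by rw [← hB.eq, h1, map_zero]
  have h2' : B f' e = 0 := by rw [← hB.eq, h2, map_zero]
  have h3' : B e' f = 0 := by rw [← hB.eq, h3, map_zero]
  have h4' : B f' f = 0 := by rw [← hB.eq, h4, map_zero]
  have hτx : τ x ≠ 0 := by simpa using hx
  obtain ⟨g, hg⟩ := IsIsometryDet.exists_specialUnitary
    ((isIsometryDet_pair hτ hB he hf hef hx).comp
    (isIsometryDet_pair hτ hB he' hf' hef' (inv_ne_zero hx))) (by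
      rw [map_inv₀]; field_simp)
  refine ⟨g, ?_, ?_, ?_, ?_, fun v hv1 hv2 hv3 hv4 => ?_⟩ <;>
    simp only [LinearMap.comp_apply, transvection.apply, LinearMap.smul_apply, map_add,
      map_smul, smul_eq_mul, mul_zero, mul_one, zero_smul, add_zero, map_inv₀, inv_inv, *]
  · module
  · module
  · module
  · module

end SpecialElements

/-! ### Hermitian geometry and faithfulness of the action. -/

section Geometry

open Module

variable {K V : Type*} [Field K] [AddCommGroup V] [Module K V] {τ : K →+* K}
  {B : V →ₛₗ[τ] V →ₗ[K] K}

theorem exists_le_ker_finrank [FiniteDimensional K V] (P : Submodule K V) {n : ℕ}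
    (φ : Fin n → Dual K V) :
    ∃ Q : Submodule K V, (∀ x, x ∈ Q ↔ x ∈ P ∧ ∀ i, φ i x = 0) ∧ finrank K P ≤ finrank K Q + n := by
  let F : P →ₗ[K] (Fin n → K) := LinearMap.pi φ ∘ₗ P.subtype
  refine ⟨(LinearMap.ker F).map P.subtype, fun x => ?_, ?_⟩
  · simp [F, funext_iff, and_comm]
  · rw [(Submodule.equivMapOfInjective _ P.subtype_injective _).symm.finrank_eq,
      ← LinearMap.finrank_range_add_finrank_ker F, add_comm]
    have := Submodule.finrank_le (LinearMap.range F)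
    simp only [finrank_fin_fun] at this
    omega

/-- For y nonsingular and x orthogonal to y, the form at x + ty is B(x,x) + N(t)B(y,y), and
surjectivity of the norm solves for t. -/
theorem exists_singular_of_two_le_finrank [FiniteDimensional K V] (hτ : IsFiniteConj τ)
    (hB : B.IsSymm) {P : Submodule K V} (hP : 2 ≤ finrank K P) :
    ∃ x ∈ P, x ≠ 0 ∧ B x x = 0 := by
  by_contra! h
  obtain ⟨y, hy⟩ : ∃ y : P, y ≠ 0 := by
    have : Nontrivial P := Module.nontrivial_of_finrank_pos (R := K) (by omega)
    exact exists_ne 0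
  have hyy : B y.1 y.1 ≠ 0 := h y.1 y.2 (by simpa using hy)
  obtain ⟨Q, hQ, hQd⟩ := exists_le_ker_finrank P (fun _ : Fin 1 => B y.1)
  obtain ⟨x, hx⟩ : ∃ x : Q, x ≠ 0 := by
    have : Nontrivial Q := Module.nontrivial_of_finrank_pos (R := K) (by omega)
    exact exists_ne 0
  obtain ⟨hxP, hyx⟩ := (hQ x.1).1 x.2
  have hyx := hyx 0
  have hxy : B x.1 y.1 = 0 := by rw [← hB.eq, hyx, map_zero]
  obtain ⟨t, ht⟩ := hτ.norm_surj (-(B x.1 x.1) / B y.1 y.1) (by simp [hB.eq])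
  refine h (x.1 + t • y.1) (P.add_mem hxP (P.smul_mem _ y.2)) ?_ ?_
  · intro h0
    have h1 := congrArg (B y.1) h0
    simp only [map_add, map_smul, hyx, smul_eq_mul, map_zero, zero_add, mul_eq_zero, hyy,
      or_false] at h1
    rw [h1, zero_smul, add_zero] at h0
    exact hx (Subtype.ext h0)
  · simp only [map_add, map_smul, map_smulₛₗ, LinearMap.add_apply, LinearMap.smul_apply, hyx, hxy,
      smul_eq_mul]
    rw [eq_div_iff hyy] at ht
    linear_combination ht

/-- Normalise z so that B(e,z) = 1; adding te changes B(z,z) by the trace of t, which can be any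
fixed element. -/
theorem exists_hyperbolic_partner (hτ : IsFiniteConj τ) (hB : B.IsSymm) {P : Submodule K V}
    {e y : V} (heP : e ∈ P) (hyP : y ∈ P) (he : B e e = 0) (hy : B e y ≠ 0) :
    ∃ f ∈ P, B f f = 0 ∧ B e f = 1 := by
  obtain ⟨z, hzP, hz⟩ : ∃ z ∈ P, B e z = 1 :=
    ⟨(B e y)⁻¹ • y, P.smul_mem _ hyP, by simp [hy]⟩
  have hz' : B z e = 1 := by rw [← hB.eq, hz, map_one]
  obtain ⟨t, ht⟩ := hτ.trace_surj (x := -B z z) (by simp [hB.eq])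
  refine ⟨z + t • e, P.add_mem hzP (P.smul_mem _ heP), ?_, by simp [hz, he]⟩
  simp only [map_add, map_smul, map_smulₛₗ, LinearMap.add_apply, LinearMap.smul_apply, hz, hz', he,
    smul_eq_mul]
  linear_combination ht

theorem exists_hyperbolic_pair [FiniteDimensional K V] (hτ : IsFiniteConj τ)
    (hB : B.IsSymm) {P : Submodule K V} (hnd : ∀ x ∈ P, x ≠ 0 → ∃ y ∈ P, B x y ≠ 0)
    (hP : 2 ≤ finrank K P) :
    ∃ e ∈ P, ∃ f ∈ P, B e e = 0 ∧ B f f = 0 ∧ B e f = 1 := by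
  obtain ⟨e, heP, he0, he⟩ := exists_singular_of_two_le_finrank hτ hB hP
  obtain ⟨y, hyP, hy⟩ := hnd e heP he0
  obtain ⟨f, hfP, hf, hef⟩ := exists_hyperbolic_partner hτ hB heP hyP he hy
  exact ⟨e, heP, f, hfP, he, hf, hef⟩

/-- On a hyperbolic pair x, f the form takes the value t + τ t at x + tf, and some trace is nonzero.
-/
theorem exists_nonsingular (hτ : IsFiniteConj τ) (hB : B.IsSymm) {P : Submodule K V}
    (hnd : ∀ x ∈ P, x ≠ 0 → ∃ y ∈ P, B x y ≠ 0) (hP : P ≠ ⊥) : ∃ w ∈ P, B w w ≠ 0 := by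
  obtain ⟨x, hxP, hx0⟩ := P.ne_bot_iff.1 hP
  by_contra! h
  obtain ⟨y, hyP, hy⟩ := hnd x hxP hx0
  obtain ⟨f, hfP, hf, hxf⟩ := exists_hyperbolic_partner hτ hB hxP hyP (h x hxP) hy
  have hfx : B f x = 1 := by rw [← hB.eq, hxf, map_one]
  obtain ⟨t, ht⟩ := hτ.trace_ne
  apply ht
  have := h (x + t • f) (P.add_mem hxP (P.smul_mem _ hfP))
  simp only [map_add, map_smul, map_smulₛₗ, LinearMap.add_apply, LinearMap.smul_apply, hf, hxf,
    hfx, h x hxP, smul_eq_mul] at this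
  linear_combination this

variable (B) in
/-- The orthogonal complement of a pair of vectors. -/
def perpPair (e f : V) : Submodule K V :=
  LinearMap.ker (B e) ⊓ LinearMap.ker (B f)

theorem mem_perpPair {e f v : V} : v ∈ perpPair B e f ↔ B e v = 0 ∧ B f v = 0 := by
  simp [perpPair]

theorem finrank_le_perpPair [FiniteDimensional K V] (e f : V) :
    finrank K V ≤ finrank K (perpPair B e f) + 2 := by
  obtain ⟨Q, hQ, h⟩ := exists_le_ker_finrank ⊤ ![B e, B f]
  obtain rfl : Q = perpPair B e f := by
    ext x
    simp [hQ, mem_perpPair, Fin.forall_fin_two]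
  simpa using h

theorem sub_mem_perpPair (hB : B.IsSymm) {e f : V} (he : B e e = 0) (hf : B f f = 0)
    (hef : B e f = 1) (v : V) : v - B f v • e - B e v • f ∈ perpPair B e f := by
  have hfe : B f e = 1 := by rw [← hB.eq, hef, map_one]
  simp [mem_perpPair, he, hf, hef, hfe]

theorem perpPair_nondegenerate (hB : B.IsSymm) (hB' : B.Nondegenerate) {e f : V} (he : B e e = 0)
    (hf : B f f = 0) (hef : B e f = 1) :
    ∀ x ∈ perpPair B e f, x ≠ 0 → ∃ y ∈ perpPair B e f, B x y ≠ 0 := by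
  intro x hx hx0
  by_contra! h
  refine hx0 (hB'.1 x fun v => ?_)
  have h1 := h _ (sub_mem_perpPair hB he hf hef v)
  obtain ⟨h2, h3⟩ := mem_perpPair.1 hx
  have h2' : B x e = 0 := by rw [← hB.eq, h2, map_zero]
  have h3' : B x f = 0 := by rw [← hB.eq, h3, map_zero]
  simpa [h2', h3'] using h1

/-- The complement of a hyperbolic pair is nondegenerate and nonzero, hence has a nonsingular
vector; scaling it multiplies its form value by an arbitrary norm. -/
theorem exists_perpPair_form_eq [FiniteDimensional K V] (hτ : IsFiniteConj τ) (hB : B.IsSymm)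
    (hB' : B.Nondegenerate) (hd : 3 ≤ finrank K V) {e f : V} (he : B e e = 0) (hf : B f f = 0)
    (hef : B e f = 1) {x : K} (hx : τ x = x) : ∃ w ∈ perpPair B e f, B w w = x := by
  obtain ⟨w, hw, hww⟩ := exists_nonsingular hτ hB (perpPair_nondegenerate hB hB' he hf hef) (by
    rintro h0
    have := finrank_le_perpPair (B := B) e f
    rw [h0, finrank_bot] at this
    omega)
  obtain ⟨t, ht⟩ := hτ.norm_surj (x / B w w) (by rw [map_div₀, hx, hB.eq])
  refine ⟨t • w, Submodule.smul_mem _ _ hw, ?_⟩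
  rw [eq_div_iff hww] at ht
  simp only [map_smul, map_smulₛₗ, LinearMap.smul_apply, smul_eq_mul]
  linear_combination ht

theorem exists_hyperbolic_pair_top [FiniteDimensional K V] (hτ : IsFiniteConj τ)
    (hB : B.IsSymm) (hB' : B.Nondegenerate) (hd : 2 ≤ finrank K V) :
    ∃ e f, B e e = 0 ∧ B f f = 0 ∧ B e f = 1 := by
  obtain ⟨a, -, b, -, h⟩ := exists_hyperbolic_pair hτ hB (P := ⊤)
    (fun x _ hx => by
      by_contra! h0
      exact hx (hB'.1 x fun y => h0 y trivial)) (by rwa [finrank_top])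
  exact ⟨a, b, h⟩

/-- A totally singular subspace of `P` extends within `P` to dimension half of that of `P`. -/
theorem exists_totallySingular_extension [FiniteDimensional K V] (hτ : IsFiniteConj τ)
    (hB : B.IsSymm) {P : Submodule K V} (m : ℕ) (hm : 2 * m ≤ finrank K P) {W₀ : Submodule K V}
    (hW₀ : W₀ ≤ P) (hs : ∀ v ∈ W₀, ∀ w ∈ W₀, B v w = 0) (hd : finrank K W₀ ≤ m) :
    ∃ W : Submodule K V, W₀ ≤ W ∧ W ≤ P ∧ finrank K W = m ∧ ∀ v ∈ W, ∀ w ∈ W, B v w = 0 := by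
  obtain ⟨j, hj⟩ : ∃ j, finrank K W₀ + j = m := ⟨m - finrank K W₀, by omega⟩
  clear hd
  induction j generalizing W₀ with
  | zero => exact ⟨W₀, le_rfl, hW₀, by omega, hs⟩
  | succ j ih =>
    let b := finBasis K W₀
    obtain ⟨Q, hQ, hQd⟩ := exists_le_ker_finrank P (fun i => B (b i : V))
    have hWQ : W₀ ≤ Q := fun w hw => (hQ w).2 ⟨hW₀ hw, fun i => hs _ (b i).2 _ hw⟩
    have hperp : ∀ w ∈ W₀, ∀ x ∈ Q, B w x = 0 := by
      intro w hw x hx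
      have h1 := b.sum_repr ⟨w, hw⟩
      have h2 := congrArg Subtype.val h1
      simp only [Submodule.coe_sum, Submodule.coe_smul] at h2
      rw [← h2]
      simp [map_sum, ((hQ x).1 hx).2]
    -- With Q the part of P orthogonal to W₀, a complement of W₀ in Q has dimension at least dim P -
    -- 2 dim W₀ ≥ 2, so it contains a singular vector to adjoin. Nondegeneracy of P is not needed.
    obtain ⟨C, hC⟩ := Submodule.exists_isCompl W₀
    have hsup : W₀ ⊔ C ⊓ Q = Q := by
      rw [← sup_inf_assoc_of_le C hWQ, hC.sup_eq_top, top_inf_eq]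
    have hinf : W₀ ⊓ (C ⊓ Q) = ⊥ := by
      rw [← inf_assoc, hC.inf_eq_bot, bot_inf_eq]
    have hfin := Submodule.finrank_sup_add_finrank_inf_eq W₀ (C ⊓ Q)
    rw [hsup, hinf, finrank_bot] at hfin
    obtain ⟨x, hxC, hx0, hx⟩ := exists_singular_of_two_le_finrank hτ hB (P := C ⊓ Q) (by omega)
    have hxW : x ∉ W₀ := fun h => hx0 (by
      have : x ∈ W₀ ⊓ (C ⊓ Q) := ⟨h, hxC⟩
      simpa [hinf] using this)
    have hxP := ((hQ x).1 hxC.2).1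
    obtain ⟨W, h1, h2, h3, h4⟩ := ih (W₀ := W₀ ⊔ K ∙ x)
      (sup_le hW₀ ((Submodule.span_singleton_le_iff_mem _ _).2 hxP)) (by
        intro v hv w hw
        obtain ⟨v, hv₀, _, hv', rfl⟩ := Submodule.mem_sup.1 hv
        obtain ⟨w, hw₀, _, hw', rfl⟩ := Submodule.mem_sup.1 hw
        obtain ⟨r, rfl⟩ := Submodule.mem_span_singleton.1 hv'
        obtain ⟨s, rfl⟩ := Submodule.mem_span_singleton.1 hw'
        have h1 := hperp v hv₀ x hxC.2
        have h2 : B x w = 0 := by rw [← hB.eq, hperp w hw₀ x hxC.2, map_zero]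
        simp [hs v hv₀ w hw₀, h1, h2, hx]) (by
        have hinf' : W₀ ⊓ K ∙ x = ⊥ := by
          rw [← disjoint_iff]
          exact (Submodule.disjoint_span_singleton' hx0).2 hxW
        have := Submodule.finrank_sup_add_finrank_inf_eq W₀ (K ∙ x)
        rw [hinf', finrank_bot, finrank_span_singleton hx0] at this
        omega)
    exact ⟨W, le_sup_left.trans h1, h2, h3, h4⟩

theorem IsSemisimilarity.map_zero {g : Equiv.Perm V} {σ : K ≃+* K} {c : K}
    (hg : IsSemisimilarity B g σ c) : g 0 = 0 := by
  simpa using hg.map_smul 0 0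

theorem IsSemisimilarity.form_eq_zero {g : Equiv.Perm V} {σ : K ≃+* K} {c : K}
    (hg : IsSemisimilarity B g σ c) {x y : V} (h : B x y = 0) : B (g x) (g y) = 0 := by
  rw [hg.map_form, h, _root_.map_zero, mul_zero]

theorem finrank_span_pair_le [FiniteDimensional K V] (x y : V) :
    finrank K (Submodule.span K {x, y}) ≤ 2 := by
  classical
  have := finrank_span_finset_le_card (R := K) ({x, y} : Finset V)
  rw [Finset.coe_pair] at this
  exact this.trans Finset.card_le_two

/-- A semisimilarity fixing all totally singular `k`-spaces fixes all singular points. -/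
theorem exists_smul_of_fixes [FiniteDimensional K V] (hτ : IsFiniteConj τ)
    (hB : B.IsSymm) (hB' : B.Nondegenerate) {k : ℕ} (hk : 1 ≤ k) (hkd : 2 * k ≤ finrank K V)
    (g : GammaU B) (h : ∀ W : TotallySingular B k, GammaU.Fixes g W.1) {a : V} (ha : B a a = 0) :
    ∃ x : K, g.1 a = x • a := by
  obtain ⟨σ, c, hg⟩ := g.2
  by_contra! hn
  have ha0 : a ≠ 0 := by
    rintro rfl
    exact hn 0 (by simp [hg.map_zero])
  have hbb : B (g.1 a) (g.1 a) = 0 := hg.form_eq_zero ha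
  -- Every small totally singular subspace through a lies in an invariant k-space, which then
  -- contains g a; so g a is orthogonal to that subspace.
  have hext : ∀ W₀ : Submodule K V, (∀ v ∈ W₀, ∀ w ∈ W₀, B v w = 0) → finrank K W₀ ≤ k → a ∈ W₀ →
      ∀ w ∈ W₀, B (g.1 a) w = 0 := by
    intro W₀ hs hd haW w hw
    obtain ⟨W, h1, -, h2, h3⟩ := exists_totallySingular_extension hτ hB (P := ⊤) k
      (by simpa using hkd) le_top hs hd
    exact h3 _ (h ⟨W, h2, h3⟩ a (h1 haW)) _ (h1 hw)
  have hspan : ∀ v ∈ K ∙ a, ∀ w ∈ K ∙ a, B v w = 0 := by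
    intro v hv w hw
    obtain ⟨r, rfl⟩ := Submodule.mem_span_singleton.1 hv
    obtain ⟨s, rfl⟩ := Submodule.mem_span_singleton.1 hw
    simp [ha]
  have hd1 : finrank K (K ∙ a) = 1 := finrank_span_singleton ha0
  have hba := hext _ hspan (by omega) (Submodule.mem_span_singleton_self a) a
    (Submodule.mem_span_singleton_self a)
  rcases hk.eq_or_lt with rfl | hk2
  · obtain ⟨r, hr⟩ := Submodule.mem_span_singleton.1
      (h ⟨K ∙ a, hd1, hspan⟩ a (Submodule.mem_span_singleton_self a))
    exact hn r hr.symm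
  -- As g a is not a multiple of a, some y is orthogonal to a but not to g a. A singular partner f
  -- of g a inside the complement of a then makes ⟨a, f⟩ contradict `hext`.
  obtain ⟨y, hay, hby⟩ : ∃ y, B a y = 0 ∧ B (g.1 a) y ≠ 0 := by
    by_contra! h0
    obtain ⟨v, hv⟩ : ∃ v, B a v ≠ 0 := by
      by_contra! h1
      exact ha0 (hB'.1 a h1)
    refine hn (τ (B (g.1 a) v / B a v)) (sub_eq_zero.1 (hB'.1 _ fun w => ?_))
    have := h0 (w - (B a w / B a v) • v) (by simp [hv])
    simp only [map_sub, map_smul, map_smulₛₗ, LinearMap.sub_apply, LinearMap.smul_apply,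
      smul_eq_mul, hτ.invol] at this ⊢
    rw [← this]
    ring
  obtain ⟨f, hfP, hf, hbf⟩ := exists_hyperbolic_partner hτ hB (P := LinearMap.ker (B a))
    (e := g.1 a) (y := y) (by rw [LinearMap.mem_ker, ← hB.eq, hba, map_zero]) hay hbb hby
  have haf : B a f = 0 := hfP
  have hfa : B f a = 0 := by rw [← hB.eq, haf, map_zero]
  have := hext (Submodule.span K {a, f}) (by
    intro v hv w hw
    obtain ⟨r, s, rfl⟩ := Submodule.mem_span_pair.1 hv
    obtain ⟨r', s', rfl⟩ := Submodule.mem_span_pair.1 hw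
    simp [ha, hf, haf, hfa]) ((finrank_span_pair_le a f).trans hk2) (Submodule.subset_span (by simp)) f
      (Submodule.subset_span (by simp))
  rw [hbf] at this
  exact one_ne_zero this

/-- A semisimilarity fixing all singular points is a scalar. -/
theorem mem_scalarSubgroup_of_singular [FiniteDimensional K V] (hτ : IsFiniteConj τ)
    (hB : B.IsSymm) (hB' : B.Nondegenerate) (hd : 3 ≤ finrank K V)
    (g : GammaU B) (h : ∀ a, B a a = 0 → ∃ x : K, g.1 a = x • a) : g ∈ scalarSubgroup B := by
  obtain ⟨σ, c, hg⟩ := g.2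
  obtain ⟨a, b, ha, hb, hab⟩ := exists_hyperbolic_pair_top hτ hB hB' (by omega)
  have hba : B b a = 1 := by rw [← hB.eq, hab, map_one]
  obtain ⟨x, hx⟩ := h a ha
  obtain ⟨y, hy⟩ := h b hb
  have hx0 : x ≠ 0 := by
    rintro rfl
    rw [zero_smul] at hx
    have := g.1.injective (hx.trans hg.map_zero.symm)
    simp [this] at hab
  have hy0 : y ≠ 0 := by
    rintro rfl
    rw [zero_smul] at hy
    have := g.1.injective (hy.trans hg.map_zero.symm)
    simp [this] at hab
  -- The vector a + zb + w is singular. Comparing the coordinates of its image with those of a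
  -- multiple determines both σ z and g w.
  have key : ∀ z w, w ∈ perpPair B a b → B w w = -(z + τ z) → σ z * y = x * z ∧ g.1 w = x • w := by
    intro z w hw hww
    obtain ⟨haw, hbw⟩ := mem_perpPair.1 hw
    have hwa : B w a = 0 := by rw [← hB.eq, haw, map_zero]
    have hwb : B w b = 0 := by rw [← hB.eq, hbw, map_zero]
    obtain ⟨n, hn⟩ := h (a + z • b + w) (by
      simp only [map_add, map_smul, map_smulₛₗ, LinearMap.add_apply, LinearMap.smul_apply, ha, hb,
        hab, hba, haw, hbw, hwa, hwb, hww, smul_eq_mul]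
      ring)
    rw [hg.map_add, hg.map_add, hg.map_smul, hx, hy] at hn
    have h1 := hg.form_eq_zero haw
    have h2 := hg.form_eq_zero hbw
    rw [hx, map_smulₛₗ, LinearMap.smul_apply, smul_eq_mul, mul_eq_zero, map_eq_zero] at h1
    rw [hy, map_smulₛₗ, LinearMap.smul_apply, smul_eq_mul, mul_eq_zero, map_eq_zero] at h2
    replace h1 := h1.resolve_left hx0
    replace h2 := h2.resolve_left hy0
    have h3 := congrArg (B b) hn
    have h4 := congrArg (B a) hn
    simp only [map_add, map_smul, ha, hb, hab, hba, haw, hbw, h1, h2, smul_eq_mul, mul_zero,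
      mul_one, add_zero, zero_add] at h3 h4
    subst h3
    refine ⟨h4, ?_⟩
    rw [smul_smul, h4, smul_add, smul_add, smul_smul] at hn
    exact add_left_cancel hn
  have hex : ∀ z, ∃ w ∈ perpPair B a b, B w w = -(z + τ z) := fun z =>
    exists_perpPair_form_eq hτ hB hB' hd ha hb hab (by simp only [map_neg, map_add, hτ.invol, add_comm])
  have hσ : ∀ z, σ z * y = x * z := fun z => by
    obtain ⟨w, hw, hww⟩ := hex z
    exact (key z w hw hww).1
  -- Every z occurs in `key`; z = 1 gives y = x, and then σ is the identity.
  have hyx : y = x := by simpa using hσ 1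
  subst hyx
  have hσ' : ∀ z, σ z = z := fun z => by
    have := hσ z
    rw [mul_comm] at this
    exact mul_left_cancel₀ hy0 this
  refine ⟨Units.mk0 y hy0, fun v => ?_⟩
  have hv : v = B b v • a + B a v • b + (v - B b v • a - B a v • b) := by abel
  obtain ⟨z, hz⟩ := hτ.trace_surj
    (x := -B (v - B b v • a - B a v • b) (v - B b v • a - B a v • b)) (by rw [map_neg, hB.eq])
  have h1 := (key z _ (sub_mem_perpPair hB ha hb hab v) (by rw [hz, neg_neg])).2
  have h2 : g.1 v = g.1 (B b v • a + B a v • b + (v - B b v • a - B a v • b)) := by rw [← hv]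
  rw [h2, hg.map_add, hg.map_add, hg.map_smul, hg.map_smul, hσ', hσ', h1, hx, hy, Units.smul_mk0]
  module

/-- The action of `G` on `Ω_k` is faithful. -/
theorem eq_one_of_forall_smul_eq [Finite V] [FiniteDimensional K V] (hτ : IsFiniteConj τ)
    (hB : B.IsSymm) (hB' : B.Nondegenerate) {k : ℕ} (hk : 1 ≤ k) (hkd : 2 * k ≤ finrank K V)
    (hd : 3 ≤ finrank K V) (G : Subgroup (PGammaU B)) (g : G)
    (h : ∀ W : TotallySingular B k, g • W = W) : g = 1 := by
  obtain ⟨g, hgG⟩ := g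
  obtain ⟨g, rfl⟩ := QuotientGroup.mk_surjective g
  simp only [Subgroup.smul_def, smul_eq_self_iff] at h
  refine Subtype.ext ((QuotientGroup.eq_one_iff g).2 ?_)
  exact mem_scalarSubgroup_of_singular hτ hB hB' hd g fun a ha =>
    exists_smul_of_fixes hτ hB hB' hk hkd g h ha

end Geometry

/-! ### Singular points: the case k = 1. -/

section Points

open Module

variable {K V : Type*} [Field K] [AddCommGroup V] [Module K V] {τ : K →+* K}
  {B : V →ₛₗ[τ] V →ₗ[K] K}

/-- The singular point spanned by a nonzero singular vector. -/
def singularPoint (a : V) (ha0 : a ≠ 0) (ha : B a a = 0) : TotallySingular B 1 :=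
  ⟨K ∙ a, finrank_span_singleton ha0, by
    intro v hv w hw
    obtain ⟨r, rfl⟩ := Submodule.mem_span_singleton.1 hv
    obtain ⟨s, rfl⟩ := Submodule.mem_span_singleton.1 hw
    simp [ha]⟩

theorem fixes_span_singleton {g : GammaU B} {a : V} :
    GammaU.Fixes g (K ∙ a) ↔ ∃ r : K, g.1 a = r • a := by
  obtain ⟨σ, c, hg⟩ := g.2
  constructor
  · intro h
    obtain ⟨r, hr⟩ := Submodule.mem_span_singleton.1 (h a (Submodule.mem_span_singleton_self a))
    exact ⟨r, hr.symm⟩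
  · rintro ⟨r, hr⟩ v hv
    obtain ⟨s, rfl⟩ := Submodule.mem_span_singleton.1 hv
    rw [hg.map_smul, hr]
    exact Submodule.smul_mem _ _ (Submodule.smul_mem _ _ (Submodule.mem_span_singleton_self a))

theorem fixes_singularPoint {g : GammaU B} {a : V} (ha0 : a ≠ 0) (ha : B a a = 0) :
    GammaU.Fixes g (singularPoint a ha0 ha).1 ↔ ∃ r : K, g.1 a = r • a :=
  fixes_span_singleton

theorem map_mem_singularPoint {u : V ≃ₗ[K] V} {a : V} (ha0 : a ≠ 0) (ha : B a a = 0) {r : K}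
    (h : u a = r • a) : ∀ v ∈ (singularPoint a ha0 ha).1, u v ∈ (singularPoint a ha0 ha).1 := by
  intro v hv
  obtain ⟨s, rfl⟩ := Submodule.mem_span_singleton.1 hv
  rw [map_smul, h]
  exact Submodule.smul_mem _ _ (Submodule.smul_mem _ _ (Submodule.mem_span_singleton_self a))

theorem exists_map_notMem_singularPoint {u : V ≃ₗ[K] V} {a : V} (ha0 : a ≠ 0) (ha : B a a = 0)
    (h : ∀ r : K, u a ≠ r • a) :
    ∃ v ∈ (singularPoint a ha0 ha).1, u v ∉ (singularPoint a ha0 ha).1 := by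
  refine ⟨a, Submodule.mem_span_singleton_self a, fun hm => ?_⟩
  obtain ⟨r, hr⟩ := Submodule.mem_span_singleton.1 hm
  exact h r hr.symm

variable (B) in
/-- Two orthogonal hyperbolic pairs. -/
structure IsHyperbolicFrame (a₁ b₁ a₂ b₂ : V) : Prop where
  a₁a₁ : B a₁ a₁ = 0
  a₁b₁ : B a₁ b₁ = 1
  a₁a₂ : B a₁ a₂ = 0
  a₁b₂ : B a₁ b₂ = 0
  b₁a₁ : B b₁ a₁ = 1
  b₁b₁ : B b₁ b₁ = 0
  b₁a₂ : B b₁ a₂ = 0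
  b₁b₂ : B b₁ b₂ = 0
  a₂a₁ : B a₂ a₁ = 0
  a₂b₁ : B a₂ b₁ = 0
  a₂a₂ : B a₂ a₂ = 0
  a₂b₂ : B a₂ b₂ = 1
  b₂a₁ : B b₂ a₁ = 0
  b₂b₁ : B b₂ b₁ = 0
  b₂a₂ : B b₂ a₂ = 1
  b₂b₂ : B b₂ b₂ = 0

theorem exists_hyperbolicFrame [FiniteDimensional K V] (hτ : IsFiniteConj τ) (hB : B.IsSymm)
    (hB' : B.Nondegenerate) (hd : 4 ≤ finrank K V) :
    ∃ a₁ b₁ a₂ b₂, IsHyperbolicFrame B a₁ b₁ a₂ b₂ := by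
  obtain ⟨a₁, b₁, h1, h2, h3⟩ := exists_hyperbolic_pair_top hτ hB hB' (by omega)
  have := finrank_le_perpPair (B := B) a₁ b₁
  obtain ⟨a₂, ha₂, b₂, hb₂, h4, h5, h6⟩ := exists_hyperbolic_pair hτ hB
    (perpPair_nondegenerate hB hB' h1 h2 h3) (by omega)
  obtain ⟨h7, h8⟩ := mem_perpPair.1 ha₂
  obtain ⟨h9, h10⟩ := mem_perpPair.1 hb₂
  refine ⟨a₁, b₁, a₂, b₂, ?_⟩
  constructor <;> first | assumption | (rw [← hB.eq]; simp [*])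

/-- An element moved by τ is none of 0, 1, -1. -/
theorem IsFiniteConj.exists_sq_ne_one {K : Type*} [Field K] {τ : K →+* K} (hτ : IsFiniteConj τ) :
    ∃ x : K, x ≠ 0 ∧ x * x ≠ 1 := by
  obtain ⟨s, hs⟩ := hτ.moved
  refine ⟨s, ?_, fun h => ?_⟩
  · rintro rfl
    simp at hs
  · rcases mul_self_eq_one_iff.1 h with rfl | rfl <;> simp at hs

/-- In dimension at least four, a point of a totally singular line is determined by two further
points of this line and a point not orthogonal to the line. -/
theorem not_isIBIS_points_of_four_le [Finite V] [FiniteDimensional K V] (hτ : IsFiniteConj τ)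
    (hB : B.IsSymm) (hB' : B.Nondegenerate) (hd : 4 ≤ finrank K V) {G : Subgroup (PGammaU B)}
    (hG : PSU B ≤ G) : ¬ IsIBIS G (TotallySingular B 1) := by
  have : Finite (PGammaU B) := inferInstance
  obtain ⟨a₁, b₁, a₂, b₂, hF⟩ := exists_hyperbolicFrame hτ hB hB' hd
  obtain ⟨t, ht0, ht⟩ := hτ.exists_skew
  obtain ⟨x, hx0, hx⟩ := hτ.exists_sq_ne_one
  have ha₁0 : a₁ ≠ 0 := by
    rintro rfl
    simpa using hF.b₁a₁
  have ha₂0 : a₂ ≠ 0 := by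
    rintro rfl
    simpa using hF.b₂a₂
  have hm0 : a₁ - a₂ ≠ 0 := fun h => by
    simpa [hF.b₁a₁, hF.b₁a₂] using congrArg (B b₁) h
  have hc0 : b₁ + b₂ ≠ 0 := fun h => by
    simpa [hF.a₁b₁, hF.a₁b₂] using congrArg (B a₁) h
  have hm : B (a₁ - a₂) (a₁ - a₂) = 0 := by simp [hF.a₁a₁, hF.a₁a₂, hF.a₂a₁, hF.a₂a₂]
  have hc : B (b₁ + b₂) (b₁ + b₂) = 0 := by simp [hF.b₁b₁, hF.b₁b₂, hF.b₂b₁, hF.b₂b₂]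
  let P₁ := singularPoint a₁ ha₁0 hF.a₁a₁
  let P₂ := singularPoint a₂ ha₂0 hF.a₂a₂
  let M := singularPoint (a₁ - a₂) hm0 hm
  let C := singularPoint (b₁ + b₂) hc0 hc
  have h1 : IsIrredundantSeq G [P₁] := by
    obtain ⟨u, hu⟩ := exists_specialUnitary_transvection hB hF.b₁b₁ ht
    refine irredundantSeq_append_singleton_of_specialUnitary hG (l := []) .nil u (by simp)
      (exists_map_notMem_singularPoint _ _ fun r hr => ht0 ?_)
    rw [hu] at hr
    simpa [hF.a₁a₁, hF.a₁b₁, hF.b₁a₁] using congrArg (B a₁) hr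
  have h2 : IsIrredundantSeq G [P₁, P₂] := by
    obtain ⟨u, hu⟩ := exists_specialUnitary_transvection hB hF.b₂b₂ ht
    refine irredundantSeq_append_singleton_of_specialUnitary hG (l := [P₁]) h1 u ?_
      (exists_map_notMem_singularPoint _ _ fun r hr => ht0 ?_)
    · simp only [List.forall_mem_singleton]
      exact map_mem_singularPoint _ _ (r := 1) (by simp [hu, hF.b₂a₁])
    · rw [hu] at hr
      simpa [hF.a₂a₂, hF.a₂b₂, hF.b₂a₂] using congrArg (B a₂) hr
  have h3 : IsIrredundantSeq G [P₁, P₂, M] := by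
    obtain ⟨u, hu₁, -, hu₂, -, -⟩ := exists_specialUnitary_torus_pair hτ.invol hB hF.a₁a₁ hF.b₁b₁
      hF.a₁b₁ hF.a₂a₂ hF.b₂b₂ hF.a₂b₂ hF.a₁a₂ hF.a₁b₂ hF.b₁a₂ hF.b₁b₂ hx0
    refine irredundantSeq_append_singleton_of_specialUnitary hG (l := [P₁, P₂]) h2 u ?_
      (exists_map_notMem_singularPoint _ _ fun r hr => hx ?_)
    · simp only [List.forall_mem_cons, List.not_mem_nil, false_imp_iff, implies_true, and_true]
      exact ⟨map_mem_singularPoint _ _ hu₁, map_mem_singularPoint _ _ hu₂⟩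
    · rw [map_sub, hu₁, hu₂] at hr
      have e1 : x = r := by simpa [hF.b₁a₁, hF.b₁a₂] using congrArg (B b₁) hr
      have e2 : x⁻¹ = r := by simpa [hF.b₂a₁, hF.b₂a₂] using congrArg (B b₂) hr
      rw [← e1] at e2
      nth_rewrite 2 [← e2]
      exact mul_inv_cancel₀ hx0
  obtain ⟨u, hu⟩ := exists_specialUnitary_transvection hB hF.a₁a₁ ht
  have hu₁ := map_mem_singularPoint (u := u.1) ha₁0 hF.a₁a₁ (r := 1) (by simp [hu, hF.a₁a₁])
  have hu₂ := map_mem_singularPoint (u := u.1) ha₂0 hF.a₂a₂ (r := 1) (by simp [hu, hF.a₁a₂])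
  have hu₃ := map_mem_singularPoint (u := u.1) hm0 hm (r := 1) (by simp [hu, hF.a₁a₁, hF.a₁a₂])
  have hu₄ : ∃ v ∈ C.1, u.1 v ∉ C.1 := by
    refine exists_map_notMem_singularPoint _ _ fun r hr => ht0 ?_
    rw [hu] at hr
    simpa [hF.a₁b₁, hF.a₁b₂, hF.b₁a₁, hF.b₁b₂, hF.b₁b₁] using congrArg (B b₁) hr
  have h4 : IsIrredundantSeq G [P₁, P₂, M, C] := by
    refine irredundantSeq_append_singleton_of_specialUnitary hG (l := [P₁, P₂, M]) h3 u ?_ hu₄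
    simp only [List.forall_mem_cons, List.not_mem_nil, false_imp_iff, implies_true, and_true]
    exact ⟨hu₁, hu₂, hu₃⟩
  have h5 : IsIrredundantSeq G [P₁, P₂, C] := by
    refine irredundantSeq_append_singleton_of_specialUnitary hG (l := [P₁, P₂]) h2 u ?_ hu₄
    simp only [List.forall_mem_cons, List.not_mem_nil, false_imp_iff, implies_true, and_true]
    exact ⟨hu₁, hu₂⟩
  refine not_isIBIS_of_irredundantSeq (eq_one_of_forall_smul_eq hτ hB hB' le_rfl (by omega)
    (by omega) G) h4 h5 (seqStabilizer_eq_of_fixes G fun g => ?_) (by simp)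
  simp only [List.forall_mem_cons, List.not_mem_nil, false_imp_iff, implies_true, and_true]
  refine ⟨fun ⟨h, h', _, h''⟩ => ⟨h, h', h''⟩, fun ⟨h, h', h''⟩ => ⟨h, h', ?_, h''⟩⟩
  obtain ⟨σ, e, hg⟩ := g.2
  obtain ⟨x, hx⟩ := (fixes_singularPoint _ _).1 h
  obtain ⟨y, hy⟩ := (fixes_singularPoint _ _).1 h'
  obtain ⟨z, hz⟩ := (fixes_singularPoint _ _).1 h''
  refine (fixes_singularPoint _ _).2 ⟨x, ?_⟩
  -- Both a₁ and a₂ have product 1 with b₁ + b₂. Hence the scalars of g at a₁ and a₂ coincide, and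
  -- the point of a₁ - a₂ is fixed.
  have e1 := hg.map_form a₁ (b₁ + b₂)
  have e2 := hg.map_form a₂ (b₁ + b₂)
  rw [hx, hz] at e1
  rw [hy, hz] at e2
  simp only [map_smulₛₗ, LinearMap.smul_apply, map_add, hF.a₁b₁, hF.a₁b₂, hF.a₂b₁, hF.a₂b₂,
    add_zero, zero_add, smul_eq_mul, mul_one, mul_zero, map_one, RingHom.id_apply] at e1 e2
  have hz0 : z ≠ 0 := by
    rintro rfl
    exact hg.ne_zero (by simpa using e1.symm)
  have hxy : x = y := τ.injective (mul_left_cancel₀ hz0 (e1.trans e2.symm))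
  have hneg : g.1 (-a₂) = -(y • a₂) := by
    have := hg.map_smul (-1) a₂
    simpa [hy] using this
  rw [sub_eq_add_neg, hg.map_add, hneg, hx, hxy, smul_add, smul_neg]

/-- In dimension three, a singular point of a hyperbolic line is determined by two further
singular points of this line and one off the line. -/
theorem not_isIBIS_points_of_three_le [Finite V] [FiniteDimensional K V] (hτ : IsFiniteConj τ)
    (hB : B.IsSymm) (hB' : B.Nondegenerate) (hd : 3 ≤ finrank K V)
    (hn : ∃ x : K, x ≠ 0 ∧ τ x * x ≠ 1) (hn' : ∃ x : K, τ x * x = 1 ∧ x ^ 3 ≠ 1)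
    {G : Subgroup (PGammaU B)} (hG : PSU B ≤ G) : ¬ IsIBIS G (TotallySingular B 1) := by
  have : Finite (PGammaU B) := inferInstance
  obtain ⟨a, b, ha, hb, hab⟩ := exists_hyperbolic_pair_top hτ hB hB' (by omega)
  have hba : B b a = 1 := by rw [← hB.eq, hab, map_one]
  -- The condition z + τ z ≠ 0 makes w nonsingular, as the torus requires; τ z ≠ z makes a + (z - τ
  -- z)b different from a. The skew coefficient makes this vector singular.
  obtain ⟨z, hz, hz'⟩ := hτ.exists_generic
  obtain ⟨w, hw, hww⟩ := exists_perpPair_form_eq hτ hB hB' hd ha hb hab (x := -(z + τ z))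
    (by simp only [map_neg, map_add, hτ.invol, add_comm])
  obtain ⟨haw, hbw⟩ := mem_perpPair.1 hw
  have hwa : B w a = 0 := by rw [← hB.eq, haw, map_zero]
  have hwb : B w b = 0 := by rw [← hB.eq, hbw, map_zero]
  have hww0 : B w w ≠ 0 := by rwa [hww, neg_ne_zero]
  obtain ⟨t, ht0, ht⟩ := hτ.exists_skew
  obtain ⟨x, hx0, hx⟩ := hn
  obtain ⟨y, hy, hy'⟩ := hn'
  have hy0 : y ≠ 0 := by
    rintro rfl
    simp at hy
  have ha0 : a ≠ 0 := by
    rintro rfl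
    simp at hab
  have hb0 : b ≠ 0 := by
    rintro rfl
    simp at hab
  have hm0 : a + (z - τ z) • b ≠ 0 := fun h => by simpa [hb, hba] using congrArg (B b) h
  have hc0 : a + z • b + w ≠ 0 := fun h => by simpa [hb, hba, hbw] using congrArg (B b) h
  have hm : B (a + (z - τ z) • b) (a + (z - τ z) • b) = 0 := by
    simp only [map_add, map_smul, map_smulₛₗ, LinearMap.add_apply, LinearMap.smul_apply, ha, hb,
      hab, hba, smul_eq_mul, map_sub, hτ.invol]
    ring
  have hc : B (a + z • b + w) (a + z • b + w) = 0 := by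
    simp only [map_add, map_smul, map_smulₛₗ, LinearMap.add_apply, LinearMap.smul_apply, ha, hb,
      hab, hba, haw, hbw, hwa, hwb, hww, smul_eq_mul]
    ring
  let P₁ := singularPoint a ha0 ha
  let P₂ := singularPoint b hb0 hb
  let M := singularPoint (a + (z - τ z) • b) hm0 hm
  let C := singularPoint (a + z • b + w) hc0 hc
  have h1 : IsIrredundantSeq G [P₁] := by
    obtain ⟨u, hu⟩ := exists_specialUnitary_transvection hB hb ht
    refine irredundantSeq_append_singleton_of_specialUnitary hG (l := []) .nil u (by simp)
      (exists_map_notMem_singularPoint _ _ fun r hr => ht0 ?_)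
    rw [hu] at hr
    simpa [ha, hab, hba] using congrArg (B a) hr
  have h2 : IsIrredundantSeq G [P₁, P₂] := by
    obtain ⟨u, hu⟩ := exists_specialUnitary_transvection hB ha ht
    refine irredundantSeq_append_singleton_of_specialUnitary hG (l := [P₁]) h1 u ?_
      (exists_map_notMem_singularPoint _ _ fun r hr => ht0 ?_)
    · simp only [List.forall_mem_singleton]
      exact map_mem_singularPoint _ _ (r := 1) (by simp [hu, ha])
    · rw [hu] at hr
      simpa [hb, hab, hba] using congrArg (B b) hr
  have h3 : IsIrredundantSeq G [P₁, P₂, M] := by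
    obtain ⟨u, hu₁, hu₂, -⟩ := exists_specialUnitary_torus hτ.invol hB ha hb hab hww0 haw hbw hx0
    refine irredundantSeq_append_singleton_of_specialUnitary hG (l := [P₁, P₂]) h2 u ?_
      (exists_map_notMem_singularPoint _ _ fun r hr => hx ?_)
    · simp only [List.forall_mem_cons, List.not_mem_nil, false_imp_iff, implies_true, and_true]
      exact ⟨map_mem_singularPoint _ _ hu₁, map_mem_singularPoint _ _ hu₂⟩
    · rw [map_add, map_smul, hu₁, hu₂] at hr
      have e1 : x = r := by simpa [hb, hba] using congrArg (B b) hr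
      have e2 := congrArg (B a) hr
      simp only [map_add, map_smul, ha, hab, smul_eq_mul, mul_zero, mul_one, zero_add] at e2
      rw [← e1, mul_comm] at e2
      have e3 := mul_right_cancel₀ (sub_ne_zero.2 (Ne.symm hz)) e2
      nth_rewrite 2 [← e3]
      exact mul_inv_cancel₀ (by simpa using hx0)
  obtain ⟨u, hu₁, hu₂, hu₃⟩ := exists_specialUnitary_torus hτ.invol hB ha hb hab hww0 haw hbw hy0
  -- For y of norm one, the torus multiplies a and b by y and w by y⁻². So it fixes M, and it moves
  -- C because y³ ≠ 1.
  have hτy : (τ y)⁻¹ = y := inv_eq_of_mul_eq_one_right hy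
  have hC : ∃ v ∈ C.1, u.1 v ∉ C.1 := by
    refine exists_map_notMem_singularPoint _ _ fun r hr => hy' ?_
    rw [map_add, map_add, map_smul, hu₁, hu₂, hu₃] at hr
    have e1 : y = r := by simpa [hb, hba, hbw] using congrArg (B b) hr
    have e2 : τ y * y⁻¹ = r := by simpa [hwa, hwb, hww0] using congrArg (B w) hr
    rw [← e1, ← div_eq_mul_inv, div_eq_iff hy0] at e2
    rw [e2] at hy
    rw [← hy]
    ring
  have hM := map_mem_singularPoint (u := u.1) hm0 hm (r := y) (by
    rw [map_add, map_smul, hu₁, hu₂, hτy, smul_add, smul_comm])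
  have h4 : IsIrredundantSeq G [P₁, P₂, M, C] := by
    refine irredundantSeq_append_singleton_of_specialUnitary hG (l := [P₁, P₂, M]) h3 u ?_ hC
    simp only [List.forall_mem_cons, List.not_mem_nil, false_imp_iff, implies_true, and_true]
    exact ⟨map_mem_singularPoint _ _ hu₁, map_mem_singularPoint _ _ hu₂, hM⟩
  have h5 : IsIrredundantSeq G [P₁, P₂, C] := by
    refine irredundantSeq_append_singleton_of_specialUnitary hG (l := [P₁, P₂]) h2 u ?_ hC
    simp only [List.forall_mem_cons, List.not_mem_nil, false_imp_iff, implies_true, and_true]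
    exact ⟨map_mem_singularPoint _ _ hu₁, map_mem_singularPoint _ _ hu₂⟩
  refine not_isIBIS_of_irredundantSeq (eq_one_of_forall_smul_eq hτ hB hB' le_rfl (by omega)
    hd G) h4 h5 (seqStabilizer_eq_of_fixes G fun g => ?_) (by simp)
  simp only [List.forall_mem_cons, List.not_mem_nil, false_imp_iff, implies_true, and_true]
  refine ⟨fun ⟨h, h', _, h''⟩ => ⟨h, h', h''⟩, fun ⟨h, h', h''⟩ => ⟨h, h', ?_, h''⟩⟩
  obtain ⟨σ, e, hg⟩ := g.2
  obtain ⟨l, hl⟩ := (fixes_singularPoint _ _).1 h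
  obtain ⟨m, hm'⟩ := (fixes_singularPoint _ _).1 h'
  obtain ⟨n, hn⟩ := (fixes_singularPoint _ _).1 h''
  refine (fixes_singularPoint _ _).2 ⟨l, ?_⟩
  -- Evaluating the form on a and b with an arbitrary scalar s gives τ l · m = τ m · l = e, and also
  -- that σ commutes with τ.
  have hform : ∀ s, τ l * m * σ s = e * σ s ∧ τ m * l * σ s = e * σ s ∧
      τ m * τ (σ s) * l = e * σ (τ s) := by
    intro s
    have e1 := hg.map_form a (s • b)
    have e2 := hg.map_form b (s • a)
    have e3 := hg.map_form (s • b) a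
    rw [hg.map_smul, hl, hm'] at e1 e2 e3
    simp only [map_smulₛₗ, LinearMap.smul_apply, hab, hba, smul_eq_mul, mul_one] at e1 e2 e3
    refine ⟨?_, ?_, ?_⟩
    · linear_combination e1
    · linear_combination e2
    · linear_combination e3
  have he0 := hg.ne_zero
  have hl1 : τ l * m = e := by simpa using (hform 1).1
  have hm1 : τ m * l = e := by simpa using (hform 1).2.1
  have hm0 : m ≠ 0 := right_ne_zero_of_mul (hl1.trans_ne he0)
  have hl0 : l ≠ 0 := right_ne_zero_of_mul (hm1.trans_ne he0)
  have hτm0 : τ m ≠ 0 := by simpa using hm0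
  have hστ : ∀ s, σ (τ s) = τ (σ s) := fun s => mul_left_cancel₀ he0 (by
    rw [← (hform s).2.2, ← hm1]; ring)
  have f1 := hg.form_eq_zero haw
  have f2 := hg.form_eq_zero hbw
  rw [hl, map_smulₛₗ, LinearMap.smul_apply, smul_eq_mul, mul_eq_zero, map_eq_zero] at f1
  rw [hm', map_smulₛₗ, LinearMap.smul_apply, smul_eq_mul, mul_eq_zero, map_eq_zero] at f2
  replace f1 := f1.resolve_left hl0
  replace f2 := f2.resolve_left hm0
  rw [hg.map_add, hg.map_add, hg.map_smul, hl, hm'] at hn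
  have h3 := congrArg (B b) hn
  have h4 := congrArg (B a) hn
  simp only [map_add, map_smul, ha, hb, hab, hba, haw, hbw, f1, f2, smul_eq_mul, mul_zero,
    mul_one, add_zero, zero_add] at h3 h4
  -- Invariance of C gives this relation for z; conjugation gives it for τ z, and the difference is
  -- the relation needed for M.
  have hσz : σ z * m = l * z := by rw [h4, h3]
  have hσz' : τ (σ z) * m = l * τ z := by
    have h6 := congrArg τ hσz
    rw [map_mul, map_mul] at h6
    apply mul_left_cancel₀ hτm0
    linear_combination m * h6 + τ z * (hl1 - hm1)
  rw [hg.map_add, hg.map_smul, hl, hm', map_sub, hστ, smul_add, smul_smul, smul_smul]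
  congr 2
  linear_combination hσz - hσz'

end Points

/-! ### Totally singular k-spaces for k ≥ 2 and q > 2. -/

section Lines

open Module Submodule

variable {K V : Type*} [Field K] [AddCommGroup V] [Module K V] {τ : K →+* K}
  {B : V →ₛₗ[τ] V →ₗ[K] K} {E : Submodule K V} {x y p q a₁ b₁ a₂ b₂ : V}

theorem mem_sup_span_pair {v : V} :
    v ∈ E ⊔ span K {x, y} ↔ ∃ e ∈ E, ∃ r s : K, v = e + (r • x + s • y) := by
  simp only [mem_sup, mem_span_pair]
  constructor
  · rintro ⟨e, he, _, ⟨r, s, rfl⟩, rfl⟩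
    exact ⟨e, he, r, s, rfl⟩
  · rintro ⟨e, he, r, s, rfl⟩
    exact ⟨e, he, _, ⟨r, s, rfl⟩, rfl⟩

theorem left_mem_sup_span_pair : x ∈ E ⊔ span K {x, y} :=
  mem_sup_right (subset_span (by simp))

theorem right_mem_sup_span_pair : y ∈ E ⊔ span K {x, y} :=
  mem_sup_right (subset_span (by simp))

theorem form_eq_zero_of_mem_sup_span_pair {z v : V} (hE : ∀ e ∈ E, B z e = 0) (hx : B z x = 0)
    (hy : B z y = 0) (hv : v ∈ E ⊔ span K {x, y}) : B z v = 0 := by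
  obtain ⟨e, he, r, s, rfl⟩ := mem_sup_span_pair.1 hv
  simp [hE e he, hx, hy]

theorem map_mem_sup_span_pair {u : V ≃ₗ[K] V} (hE : ∀ e ∈ E, u e = e)
    (hx : u x ∈ E ⊔ span K {x, y}) (hy : u y ∈ E ⊔ span K {x, y}) :
    ∀ v ∈ E ⊔ span K {x, y}, u v ∈ E ⊔ span K {x, y} := by
  intro v hv
  obtain ⟨e, he, r, s, rfl⟩ := mem_sup_span_pair.1 hv
  rw [map_add, map_add, map_smul, map_smul, hE e he]
  exact add_mem (mem_sup_left he) (add_mem (smul_mem _ _ hx) (smul_mem _ _ hy))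

theorem map_mem_sup_span_pair_of_eq {u : V ≃ₗ[K] V} (hE : ∀ e ∈ E, u e = e)
    (hx : u x = x) (hy : u y = y) :
    ∀ v ∈ E ⊔ span K {x, y}, u v ∈ E ⊔ span K {x, y} :=
  map_mem_sup_span_pair hE (by rw [hx]; exact left_mem_sup_span_pair)
    (by rw [hy]; exact right_mem_sup_span_pair)

theorem fixes_sup_span_pair {g : GammaU B} (hE : ∀ e ∈ E, g.1 e ∈ E ⊔ span K {x, y})
    (hx : g.1 x ∈ E ⊔ span K {x, y}) (hy : g.1 y ∈ E ⊔ span K {x, y}) :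
    GammaU.Fixes g (E ⊔ span K {x, y}) := by
  obtain ⟨σ, c, hg⟩ := g.2
  intro v hv
  obtain ⟨e, he, r, s, rfl⟩ := mem_sup_span_pair.1 hv
  rw [hg.map_add, hg.map_add, hg.map_smul, hg.map_smul]
  exact add_mem (hE e he) (add_mem (smul_mem _ _ hx) (smul_mem _ _ hy))

variable (B E x y p q) in
/-- `x, y` span a totally singular line orthogonal to `E`, with dual vectors `p, q` orthogonal
to `E`. -/
structure IsDualPair : Prop where
  px : B p x = 1
  py : B p y = 0
  qx : B q x = 0
  qy : B q y = 1
  pE : ∀ e ∈ E, B p e = 0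
  qE : ∀ e ∈ E, B q e = 0
  xx : B x x = 0
  xy : B x y = 0
  yy : B y y = 0
  xE : ∀ e ∈ E, B x e = 0
  yE : ∀ e ∈ E, B y e = 0

/-- Since p and q vanish on E and are dual to x and y, they read off the two coordinates modulo E.
-/
theorem IsDualPair.mem_iff (h : IsDualPair B E x y p q) {v : V} :
    v ∈ E ⊔ span K {x, y} ↔ ∃ e ∈ E, v = e + (B p v • x + B q v • y) := by
  rw [mem_sup_span_pair]
  constructor
  · rintro ⟨e, he, r, s, rfl⟩
    exact ⟨e, he, by simp [h.px, h.py, h.qx, h.qy, h.pE e he, h.qE e he]⟩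
  · rintro ⟨e, he, hv⟩
    exact ⟨e, he, _, _, hv⟩

theorem IsDualPair.exists_totallySingular [FiniteDimensional K V] (h : IsDualPair B E x y p q)
    (hB : B.IsSymm) (hE : ∀ v ∈ E, ∀ w ∈ E, B v w = 0) {j : ℕ} (hj : finrank K E = j) :
    ∃ W : TotallySingular B (j + 2), W.1 = E ⊔ span K {x, y} := by
  have hli : LinearIndependent K ![x, y] := by
    refine LinearIndependent.pair_iff.2 fun r s hrs => ⟨?_, ?_⟩
    · simpa [h.px, h.py] using congrArg (B p) hrs
    · simpa [h.qx, h.qy] using congrArg (B q) hrs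
  have hspan : finrank K (span K {x, y}) = 2 := by
    have := finrank_span_eq_card hli
    rwa [Matrix.range_cons, Matrix.range_cons, Matrix.range_empty, Set.union_empty,
      Set.singleton_union] at this
  have hinf : E ⊓ span K {x, y} = ⊥ := by
    refine eq_bot_iff.2 fun v hv => ?_
    obtain ⟨r, s, rfl⟩ := mem_span_pair.1 hv.2
    have hr : r = 0 := by simpa [h.px, h.py] using h.pE _ hv.1
    have hs : s = 0 := by simpa [h.qx, h.qy] using h.qE _ hv.1
    simp [hr, hs]
  refine ⟨⟨E ⊔ span K {x, y}, ?_, ?_⟩, rfl⟩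
  · have := finrank_sup_add_finrank_inf_eq E (span K {x, y})
    rw [hinf, finrank_bot, hspan, hj] at this
    exact this
  · intro v hv w hw
    obtain ⟨e, he, r, s, rfl⟩ := mem_sup_span_pair.1 hv
    obtain ⟨e', he', r', s', rfl⟩ := mem_sup_span_pair.1 hw
    have hyx : B y x = 0 := by rw [← hB.eq, h.xy, map_zero]
    have hex : B e x = 0 := by rw [← hB.eq, h.xE e he, map_zero]
    have hey : B e y = 0 := by rw [← hB.eq, h.yE e he, map_zero]
    simp [hE e he e' he', h.xE e' he', h.yE e' he', hex, hey, hyx, h.xx, h.xy, h.yy]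

variable (B E a₁ b₁ a₂ b₂) in
/-- `E` is totally singular and orthogonal to the given frame. -/
structure IsFrameComplement : Prop where
  sing : ∀ v ∈ E, ∀ w ∈ E, B v w = 0
  a₁E : ∀ e ∈ E, B a₁ e = 0
  b₁E : ∀ e ∈ E, B b₁ e = 0
  a₂E : ∀ e ∈ E, B a₂ e = 0
  b₂E : ∀ e ∈ E, B b₂ e = 0

-- The vectors orthogonal to the frame form a space of dimension at least d - 4 ≥ 2j, which
-- therefore contains a totally singular j-space.
variable (a₁ b₁ a₂ b₂) in
theorem exists_frameComplement [FiniteDimensional K V] (hτ : IsFiniteConj τ) (hB : B.IsSymm)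
    {j : ℕ} (hj : 2 * (j + 2) ≤ finrank K V) :
    ∃ E : Submodule K V, finrank K E = j ∧ IsFrameComplement B E a₁ b₁ a₂ b₂ := by
  obtain ⟨Q, hQ, hQd⟩ := exists_le_ker_finrank ⊤ ![B a₁, B b₁, B a₂, B b₂]
  rw [finrank_top] at hQd
  obtain ⟨E, -, hEQ, hE, hs⟩ := exists_totallySingular_extension hτ hB (P := Q) j (by omega)
    (W₀ := ⊥) bot_le (by simp) (by simp)
  have h := fun e (he : e ∈ E) => ((hQ e).1 (hEQ he)).2
  exact ⟨E, hE, hs, fun e he => h e he 0, fun e he => h e he 1, fun e he => h e he 2,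
    fun e he => h e he 3⟩

/-- For `q > 2`: if two totally singular `k`-spaces meet in codimension one, then the `k`-space
through their intersection that meets a suitable third one is determined by these three. -/
theorem not_isIBIS_of_exists_norm_ne_one [Finite V] [FiniteDimensional K V] (hτ : IsFiniteConj τ)
    (hB : B.IsSymm) (hB' : B.Nondegenerate) {j : ℕ} (hd : 2 * (j + 2) ≤ finrank K V)
    (hn : ∃ x : K, x ≠ 0 ∧ τ x * x ≠ 1)
    {G : Subgroup (PGammaU B)} (hG : PSU B ≤ G) : ¬ IsIBIS G (TotallySingular B (j + 2)) := by
  have : Finite (PGammaU B) := inferInstance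
  obtain ⟨a₁, b₁, a₂, b₂, hF⟩ := exists_hyperbolicFrame hτ hB hB' (by omega)
  obtain ⟨E, hEj, hs, hE₁, hE₂, hE₃, hE₄⟩ := exists_frameComplement a₁ b₁ a₂ b₂ hτ hB hd
  obtain ⟨f₁, f₂, f₃, f₄, f₅, f₆, f₇, f₈, f₉, f₁₀, f₁₁, f₁₂, f₁₃, f₁₄, f₁₅, f₁₆⟩ := id hF
  obtain ⟨t, ht0, ht⟩ := hτ.exists_skew
  obtain ⟨x, hx0, hx⟩ := hn
  -- Since t is skew, a₂ + tb₂ is singular.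
  have hmE : ∀ e ∈ E, B (a₂ + t • b₂) e = 0 := fun e he => by simp [hE₃ e he, hE₄ e he]
  have hmm : B (a₂ + t • b₂) (a₂ + t • b₂) = 0 := by simp [*]
  have dP : IsDualPair B E a₁ a₂ b₁ b₂ := by constructor <;> assumption
  have dQ : IsDualPair B E a₁ b₂ b₁ a₂ := by constructor <;> assumption
  have dM : IsDualPair B E a₁ (a₂ + t • b₂) b₁ b₂ := by constructor <;> first | assumption | simp [*]
  have dC : IsDualPair B E b₁ (a₂ + t • b₂) a₁ b₂ := by constructor <;> first | assumption | simp [*]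
  obtain ⟨P, hP⟩ := dP.exists_totallySingular hB hs hEj
  obtain ⟨Q, hQ⟩ := dQ.exists_totallySingular hB hs hEj
  obtain ⟨M, hM⟩ := dM.exists_totallySingular hB hs hEj
  obtain ⟨C, hC⟩ := dC.exists_totallySingular hB hs hEj
  have h1 : IsIrredundantSeq G [P] := by
    obtain ⟨u, hu⟩ := exists_specialUnitary_transvection hB hF.b₁b₁ ht
    refine irredundantSeq_append_singleton_of_specialUnitary hG (l := []) .nil u (by simp)
      ⟨a₁, ?_, fun h => ht0 ?_⟩
    · rw [hP]
      exact left_mem_sup_span_pair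
    · rw [hP] at h
      simpa [hu, f₁, f₂, f₅] using form_eq_zero_of_mem_sup_span_pair hE₁ f₁ f₃ h
  have h2 : IsIrredundantSeq G [P, Q] := by
    obtain ⟨u, hu⟩ := exists_specialUnitary_transvection hB hF.a₂a₂ ht
    refine irredundantSeq_append_singleton_of_specialUnitary hG (l := [P]) h1 u ?_
      ⟨b₂, ?_, fun h => ht0 ?_⟩
    · rw [List.forall_mem_singleton, hP]
      exact map_mem_sup_span_pair_of_eq (fun e he => by simp [hu, hE₃ e he]) (by simp [*])
        (by simp [*])
    · rw [hQ]
      exact right_mem_sup_span_pair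
    · rw [hQ] at h
      simpa [*] using form_eq_zero_of_mem_sup_span_pair hE₄ f₁₃ f₁₆ h
  have h3 : IsIrredundantSeq G [P, Q, M] := by
    obtain ⟨u, hu₁, hu₂, hu₃, -, hu⟩ := exists_specialUnitary_torus_pair hτ.invol hB hF.a₂a₂ hF.b₂b₂
      hF.a₂b₂ hF.a₁a₁ hF.b₁b₁ hF.a₁b₁ hF.a₂a₁ hF.a₂b₁ hF.b₂a₁ hF.b₂b₁ hx0
    have huE : ∀ e ∈ E, u.1 e = e := fun e he =>
      hu e (hE₃ e he) (hE₄ e he) (hE₁ e he) (hE₂ e he)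
    refine irredundantSeq_append_singleton_of_specialUnitary hG (l := [P, Q]) h2 u ?_
      ⟨a₂ + t • b₂, ?_, fun h => hx ?_⟩
    · simp only [List.forall_mem_cons, List.not_mem_nil, false_imp_iff, implies_true, and_true,
        hP, hQ]
      refine ⟨map_mem_sup_span_pair huE ?_ ?_, map_mem_sup_span_pair huE ?_ ?_⟩
      · rw [hu₃]
        exact smul_mem _ _ left_mem_sup_span_pair
      · rw [hu₁]
        exact smul_mem _ _ right_mem_sup_span_pair
      · rw [hu₃]
        exact smul_mem _ _ left_mem_sup_span_pair
      · rw [hu₂]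
        exact smul_mem _ _ right_mem_sup_span_pair
    · rw [hM]
      exact right_mem_sup_span_pair
    · rw [hM] at h
      obtain ⟨e, he, r, s, h⟩ := mem_sup_span_pair.1 h
      rw [map_add, map_smul, hu₁, hu₂] at h
      have e1 : x = s := by simpa [f₁₃, f₁₅, f₁₆, hE₄ e he] using congrArg (B b₂) h
      have e2 := congrArg (B a₂) h
      simp only [map_add, map_smul, hE₃ e he, f₉, f₁₁, f₁₂, smul_eq_mul, mul_zero, mul_one,
        zero_add] at e2
      rw [← e1, mul_comm] at e2
      have e3 := mul_right_cancel₀ ht0 e2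
      nth_rewrite 2 [← e3]
      exact mul_inv_cancel₀ (by simpa using hx0)
  obtain ⟨u, hu⟩ := exists_specialUnitary_transvection hB hF.a₁a₁ ht
  have huE : ∀ e ∈ E, u.1 e = e := fun e he => by simp [hu, hE₁ e he]
  have huC : ∃ v ∈ C.1, u.1 v ∉ C.1 := by
    rw [hC]
    refine ⟨b₁, left_mem_sup_span_pair, fun h => ht0 ?_⟩
    simpa [*] using form_eq_zero_of_mem_sup_span_pair hE₂ f₆ (by simp [*]) h
  have huP : ∀ v ∈ P.1, u.1 v ∈ P.1 := by
    rw [hP]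
    exact map_mem_sup_span_pair_of_eq huE (by simp [*]) (by simp [*])
  have huQ : ∀ v ∈ Q.1, u.1 v ∈ Q.1 := by
    rw [hQ]
    exact map_mem_sup_span_pair_of_eq huE (by simp [*]) (by simp [*])
  have huM : ∀ v ∈ M.1, u.1 v ∈ M.1 := by
    rw [hM]
    exact map_mem_sup_span_pair_of_eq huE (by simp [*]) (by simp [*])
  have h4 : IsIrredundantSeq G [P, Q, M, C] := by
    refine irredundantSeq_append_singleton_of_specialUnitary hG (l := [P, Q, M]) h3 u ?_ huC
    simp only [List.forall_mem_cons, List.not_mem_nil, false_imp_iff, implies_true, and_true]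
    exact ⟨huP, huQ, huM⟩
  have h5 : IsIrredundantSeq G [P, Q, C] := by
    refine irredundantSeq_append_singleton_of_specialUnitary hG (l := [P, Q]) h2 u ?_ huC
    simp only [List.forall_mem_cons, List.not_mem_nil, false_imp_iff, implies_true, and_true]
    exact ⟨huP, huQ⟩
  refine not_isIBIS_of_irredundantSeq (eq_one_of_forall_smul_eq hτ hB hB' (by omega) hd
    (by omega) G) h4 h5 (seqStabilizer_eq_of_fixes G fun g => ?_) (by simp)
  simp only [List.forall_mem_cons, List.not_mem_nil, false_imp_iff, implies_true, and_true]
  refine ⟨fun ⟨h, h', _, h''⟩ => ⟨h, h', h''⟩, fun ⟨h, h', h''⟩ => ⟨h, h', ?_, h''⟩⟩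
  rw [hP] at h
  rw [hQ] at h'
  rw [hC] at h''
  rw [hM]
  obtain ⟨σ, c, hg⟩ := g.2
  -- Image vectors of P ∩ Q lie in P and in Q, hence in E + ⟨a₁⟩, which is contained in M.
  have hinter : ∀ v, v ∈ E ⊔ span K {a₁, a₂} → v ∈ E ⊔ span K {a₁, b₂} →
      g.1 v ∈ E ⊔ span K {a₁, a₂ + t • b₂} := by
    intro v hv hv'
    obtain ⟨e, he, h6⟩ := dP.mem_iff.1 (h v hv)
    rw [form_eq_zero_of_mem_sup_span_pair hE₄ f₁₃ f₁₆ (h' v hv'), zero_smul, add_zero] at h6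
    rw [h6]
    exact add_mem (mem_sup_left he) (smul_mem _ _ left_mem_sup_span_pair)
  refine fixes_sup_span_pair (fun e he => hinter e (mem_sup_left he) (mem_sup_left he))
    (hinter a₁ left_mem_sup_span_pair left_mem_sup_span_pair) ?_
  obtain ⟨e, he, h6⟩ := dC.mem_iff.1 (h'' _ right_mem_sup_span_pair)
  -- The vector a₂ + tb₂ lies in P + Q, whose image is again inside P + Q, hence orthogonal to a₁.
  -- This removes the b₁-coordinate of its image in C.
  have h7 : B a₁ (g.1 (a₂ + t • b₂)) = 0 := by
    rw [hg.map_add, hg.map_smul, map_add, map_smul,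
      form_eq_zero_of_mem_sup_span_pair hE₁ f₁ f₃ (h _ right_mem_sup_span_pair),
      form_eq_zero_of_mem_sup_span_pair hE₁ f₁ f₄ (h' _ right_mem_sup_span_pair), smul_zero,
      add_zero]
  rw [h7, zero_smul, zero_add] at h6
  rw [h6]
  exact add_mem (mem_sup_left he) (smul_mem _ _ right_mem_sup_span_pair)

end Lines

/-! ### Totally singular k-spaces for k ≥ 2 and q = 2. -/

section LinesOverF4

open Module Submodule

variable {K V : Type*} [Field K] [AddCommGroup V] [Module K V] {τ : K →+* K}
  {B : V →ₛₗ[τ] V →ₗ[K] K} {E : Submodule K V} {x y p q a₁ b₁ a₂ b₂ : V}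

/-- `g` multiplies `v` by `r` modulo `E`. -/
def ActsAs (g : GammaU B) (E : Submodule K V) (r : K) (v : V) : Prop :=
  ∃ e ∈ E, g.1 v = e + r • v

theorem ActsAs.add {g : GammaU B} {r : K} {v w : V} (hv : ActsAs g E r v) (hw : ActsAs g E r w) :
    ActsAs g E r (v + w) := by
  obtain ⟨σ, c, hg⟩ := g.2
  obtain ⟨e, he, hv⟩ := hv
  obtain ⟨e', he', hw⟩ := hw
  refine ⟨e + e', add_mem he he', ?_⟩
  rw [hg.map_add, hv, hw]
  module

theorem ActsAs.fixes {g : GammaU B} {r : K} (hE : ∀ e ∈ E, g.1 e ∈ E) (hx : ActsAs g E r x)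
    (hy : ActsAs g E r y) : GammaU.Fixes g (E ⊔ span K {x, y}) := by
  obtain ⟨e, he, hx⟩ := hx
  obtain ⟨e', he', hy⟩ := hy
  refine fixes_sup_span_pair (fun v hv => mem_sup_left (hE v hv)) ?_ ?_
  · rw [hx]
    exact add_mem (mem_sup_left he) (smul_mem _ _ left_mem_sup_span_pair)
  · rw [hy]
    exact add_mem (mem_sup_left he') (smul_mem _ _ right_mem_sup_span_pair)

/-- E is the intersection of the two invariant spaces E + ⟨a₁, a₂⟩ and E + ⟨b₁, b₂⟩. -/
theorem map_mem_of_fixes_opposite (hF : IsHyperbolicFrame B a₁ b₁ a₂ b₂)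
    (hE : IsFrameComplement B E a₁ b₁ a₂ b₂) {g : GammaU B}
    (hA : GammaU.Fixes g (E ⊔ span K {a₁, a₂})) (hA' : GammaU.Fixes g (E ⊔ span K {b₁, b₂})) :
    ∀ e ∈ E, g.1 e ∈ E := by
  intro e he
  have d : IsDualPair B E a₁ a₂ b₁ b₂ :=
    ⟨hF.b₁a₁, hF.b₁a₂, hF.b₂a₁, hF.b₂a₂, hE.b₁E, hE.b₂E, hF.a₁a₁, hF.a₁a₂, hF.a₂a₂, hE.a₁E, hE.a₂E⟩
  obtain ⟨e', he', h⟩ := d.mem_iff.1 (hA e (mem_sup_left he))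
  have h' := hA' e (mem_sup_left he)
  rw [form_eq_zero_of_mem_sup_span_pair hE.b₁E hF.b₁b₁ hF.b₁b₂ h',
    form_eq_zero_of_mem_sup_span_pair hE.b₂E hF.b₂b₁ hF.b₂b₂ h', zero_smul, zero_smul, add_zero,
    add_zero] at h
  rwa [h]

/-- For `q = 2`: a configuration of four totally singular `k`-spaces with the same stabilizer as
one of five totally singular `k`-spaces. -/
theorem not_isIBIS_of_norm_eq_one [Finite V] [FiniteDimensional K V] (hτ : IsFiniteConj τ)
    (hB : B.IsSymm) (hB' : B.Nondegenerate) {j : ℕ} (hd : 2 * (j + 2) ≤ finrank K V)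
    (hn : ∀ x : K, x ≠ 0 → τ x * x = 1) (h2 : (1 : K) + 1 = 0)
    {G : Subgroup (PGammaU B)} (hG : PSU B ≤ G) : ¬ IsIBIS G (TotallySingular B (j + 2)) := by
  have : Finite (PGammaU B) := inferInstance
  obtain ⟨a₁, b₁, a₂, b₂, hF⟩ := exists_hyperbolicFrame hτ hB hB' (by omega)
  obtain ⟨E, hEj, hE⟩ := exists_frameComplement a₁ b₁ a₂ b₂ hτ hB hd
  obtain ⟨hs, hE₁, hE₂, hE₃, hE₄⟩ := id hE
  obtain ⟨f₁, f₂, f₃, f₄, f₅, f₆, f₇, f₈, f₉, f₁₀, f₁₁, f₁₂, f₁₃, f₁₄, f₁₅, f₁₆⟩ := id hF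
  obtain ⟨t, ht0, ht⟩ := hτ.exists_skew
  obtain ⟨x, hx0, hx⟩ := hτ.exists_sq_ne_one
  have d₁ : IsDualPair B E a₁ a₂ b₁ b₂ := by constructor <;> assumption
  have d₂ : IsDualPair B E b₁ b₂ a₁ a₂ := by constructor <;> assumption
  -- Modulo E, the spaces W₃ to W₇ are graphs of maps from ⟨a₁, a₂⟩ to ⟨b₁, b₂⟩ with matrices
  -- diag(1,0), diag(0,1), [[1,1],[1,1]], the identity and [[1,1],[1,0]]. They are totally singular
  -- because these matrices are symmetric with entries 0 and 1, and 1 + 1 = 0.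
  have d₃ : IsDualPair B E (a₁ + b₁) a₂ b₁ b₂ := by
    constructor <;> first | assumption | simp +contextual [*]
  have d₄ : IsDualPair B E a₁ (a₂ + b₂) b₁ b₂ := by
    constructor <;> first | assumption | simp +contextual [*]
  have d₅ : IsDualPair B E (a₁ + b₁ + b₂) (a₂ + b₁ + b₂) b₁ b₂ := by
    constructor <;> first | assumption | simp +contextual [*]
  have d₆ : IsDualPair B E (a₁ + b₁) (a₂ + b₂) b₁ b₂ := by
    constructor <;> first | assumption | simp +contextual [*]
  have d₇ : IsDualPair B E (a₁ + b₁ + b₂) (a₂ + b₁) b₁ b₂ := by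
    constructor <;> first | assumption | simp +contextual [*]
  obtain ⟨W₁, hW₁⟩ := d₁.exists_totallySingular hB hs hEj
  obtain ⟨W₂, hW₂⟩ := d₂.exists_totallySingular hB hs hEj
  obtain ⟨W₃, hW₃⟩ := d₃.exists_totallySingular hB hs hEj
  obtain ⟨W₄, hW₄⟩ := d₄.exists_totallySingular hB hs hEj
  obtain ⟨W₅, hW₅⟩ := d₅.exists_totallySingular hB hs hEj
  obtain ⟨W₆, hW₆⟩ := d₆.exists_totallySingular hB hs hEj
  obtain ⟨W₇, hW₇⟩ := d₇.exists_totallySingular hB hs hEj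
  have g₁ : IsIrredundantSeq G [W₁] := by
    obtain ⟨u, hu⟩ := exists_specialUnitary_transvection hB hF.b₁b₁ ht
    refine irredundantSeq_append_singleton_of_specialUnitary hG (l := []) .nil u (by simp)
      ⟨a₁, ?_, fun h => ht0 ?_⟩
    · rw [hW₁]
      exact left_mem_sup_span_pair
    · rw [hW₁] at h
      simpa [*] using form_eq_zero_of_mem_sup_span_pair hE₁ f₁ f₃ h
  have g₂ : IsIrredundantSeq G [W₁, W₂] := by
    obtain ⟨u, hu⟩ := exists_specialUnitary_transvection hB hF.a₁a₁ ht
    refine irredundantSeq_append_singleton_of_specialUnitary hG (l := [W₁]) g₁ u ?_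
      ⟨b₁, ?_, fun h => ht0 ?_⟩
    · rw [List.forall_mem_singleton, hW₁]
      exact map_mem_sup_span_pair_of_eq (fun e he => by simp [*]) (by simp [*]) (by simp [*])
    · rw [hW₂]
      exact left_mem_sup_span_pair
    · rw [hW₂] at h
      simpa [*] using form_eq_zero_of_mem_sup_span_pair hE₂ f₆ f₈ h
  -- Both Siegel elements preserve W₁ and W₂; they act on the a's and on the b's as opposite
  -- elementary matrices.
  obtain ⟨u, hu⟩ := exists_specialUnitary_siegel hτ.invol hB f₁ f₁₆ f₄ 1
  obtain ⟨u', hu'⟩ := exists_specialUnitary_siegel hτ.invol hB f₁₁ f₆ f₁₀ 1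
  have hneg : ∀ v : V, -v = v := fun v => by
    have : (-1 : K) = 1 := by linear_combination -h2
    rw [← neg_one_smul K v, this, one_smul]
  have huE : ∀ e ∈ E, u.1 e = e := fun e he => by simp [*]
  have hua₁ : u.1 a₁ = a₁ := by simp [*]
  have hua₂ : u.1 a₂ = a₂ + a₁ := by simp [*]
  have hub₁ : u.1 b₁ = b₁ + b₂ := by simp [*, sub_eq_add_neg]
  have hub₂ : u.1 b₂ = b₂ := by simp [*]
  have huE' : ∀ e ∈ E, u'.1 e = e := fun e he => by simp [*]
  have hua₁' : u'.1 a₁ = a₁ + a₂ := by simp [*]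
  have hua₂' : u'.1 a₂ = a₂ := by simp [*]
  have hub₁' : u'.1 b₁ = b₁ := by simp [*]
  have hub₂' : u'.1 b₂ = b₂ + b₁ := by simp [*, sub_eq_add_neg]
  clear hu hu'
  have huW₁ : ∀ v ∈ W₁.1, u.1 v ∈ W₁.1 := by
    rw [hW₁]
    refine map_mem_sup_span_pair huE ?_ ?_
    · rw [hua₁]
      exact left_mem_sup_span_pair
    · rw [hua₂]
      exact add_mem right_mem_sup_span_pair left_mem_sup_span_pair
  have huW₂ : ∀ v ∈ W₂.1, u.1 v ∈ W₂.1 := by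
    rw [hW₂]
    refine map_mem_sup_span_pair huE ?_ ?_
    · rw [hub₁]
      exact add_mem left_mem_sup_span_pair right_mem_sup_span_pair
    · rw [hub₂]
      exact right_mem_sup_span_pair
  have huW₁' : ∀ v ∈ W₁.1, u'.1 v ∈ W₁.1 := by
    rw [hW₁]
    refine map_mem_sup_span_pair huE' ?_ ?_
    · rw [hua₁']
      exact add_mem left_mem_sup_span_pair right_mem_sup_span_pair
    · rw [hua₂']
      exact right_mem_sup_span_pair
  have huW₂' : ∀ v ∈ W₂.1, u'.1 v ∈ W₂.1 := by
    rw [hW₂]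
    refine map_mem_sup_span_pair huE' ?_ ?_
    · rw [hub₁']
      exact left_mem_sup_span_pair
    · rw [hub₂']
      exact add_mem right_mem_sup_span_pair left_mem_sup_span_pair
  have g₃ : IsIrredundantSeq G [W₁, W₂, W₃] := by
    refine irredundantSeq_append_singleton_of_specialUnitary hG (l := [W₁, W₂]) g₂ u ?_
      ⟨a₁ + b₁, ?_, fun h => ?_⟩
    · simp only [List.forall_mem_cons, List.not_mem_nil, false_imp_iff, implies_true, and_true]
      exact ⟨huW₁, huW₂⟩
    · rw [hW₃]
      exact left_mem_sup_span_pair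
    · rw [hW₃] at h
      have := form_eq_zero_of_mem_sup_span_pair hE₃ (by simp [f₉, f₁₀]) f₁₁ h
      simp [hua₁, hub₁, f₉, f₁₀, f₁₂] at this
  have g₄ : IsIrredundantSeq G [W₁, W₂, W₃, W₄] := by
    refine irredundantSeq_append_singleton_of_specialUnitary hG (l := [W₁, W₂, W₃]) g₃ u' ?_
      ⟨a₂ + b₂, ?_, fun h => ?_⟩
    · simp only [List.forall_mem_cons, List.not_mem_nil, false_imp_iff, implies_true, and_true]
      refine ⟨huW₁', huW₂', ?_⟩
      rw [hW₃]
      refine map_mem_sup_span_pair huE' ?_ ?_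
      · rw [map_add, hua₁', hub₁', add_right_comm]
        exact add_mem left_mem_sup_span_pair right_mem_sup_span_pair
      · rw [hua₂']
        exact right_mem_sup_span_pair
    · rw [hW₄]
      exact right_mem_sup_span_pair
    · rw [hW₄] at h
      have := form_eq_zero_of_mem_sup_span_pair hE₁ f₁ (by simp [f₃, f₄]) h
      simp [hua₂', hub₂', f₂, f₃, f₄] at this
  -- As all norms are one, the torus multiplies a₁, b₁ by x and a₂, b₂ by x⁻¹. This preserves the
  -- diagonal graphs, but not the all-ones graph, because x ≠ x⁻¹.
  have g₅ : IsIrredundantSeq G [W₁, W₂, W₃, W₄, W₅] := by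
    obtain ⟨z, hz₁, hz₂, hz₃, hz₄, hz⟩ := exists_specialUnitary_torus_pair hτ.invol hB f₁ f₆ f₂ f₁₁
      f₁₆ f₁₂ f₃ f₄ f₇ f₈ hx0
    rw [inv_eq_of_mul_eq_one_right (hn x hx0)] at hz₂
    rw [eq_inv_of_mul_eq_one_left (hn x hx0)] at hz₄
    have hzE : ∀ e ∈ E, z.1 e = e := fun e he => hz e (hE₁ e he) (hE₂ e he) (hE₃ e he) (hE₄ e he)
    refine irredundantSeq_append_singleton_of_specialUnitary hG (l := [W₁, W₂, W₃, W₄]) g₄ z ?_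
      ⟨a₁ + b₁ + b₂, ?_, fun h => hx ?_⟩
    · simp only [List.forall_mem_cons, List.not_mem_nil, false_imp_iff, implies_true, and_true,
        hW₁, hW₂, hW₃, hW₄]
      refine ⟨map_mem_sup_span_pair hzE ?_ ?_, map_mem_sup_span_pair hzE ?_ ?_,
        map_mem_sup_span_pair hzE ?_ ?_, map_mem_sup_span_pair hzE ?_ ?_⟩ <;>
      simp only [map_add, hz₁, hz₂, hz₃, hz₄, ← smul_add] <;> apply smul_mem <;>
      first | exact left_mem_sup_span_pair | exact right_mem_sup_span_pair
    · rw [hW₅]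
      exact left_mem_sup_span_pair
    · rw [hW₅] at h
      have := form_eq_zero_of_mem_sup_span_pair (B := B) (z := a₁ - a₂)
        (fun e he => by simp [hE₁ e he, hE₃ e he])
        (by simp [f₁, f₂, f₄, f₉, f₁₀, f₁₂]) (by simp [f₃, f₂, f₄, f₁₁, f₁₀, f₁₂]) h
      simp only [map_add, hz₁, hz₂, hz₄, map_sub, LinearMap.sub_apply, map_smul, f₁, f₂, f₄, f₉,
        f₁₀, f₁₂, smul_eq_mul, mul_zero, mul_one, zero_add, zero_sub, sub_zero] at this
      have e1 : x = x⁻¹ := by linear_combination this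
      nth_rewrite 2 [e1]
      exact mul_inv_cancel₀ hx0
  have g₆ : IsIrredundantSeq G [W₁, W₂, W₆] := by
    refine irredundantSeq_append_singleton_of_specialUnitary hG (l := [W₁, W₂]) g₂ u ?_
      ⟨a₁ + b₁, ?_, fun h => ?_⟩
    · simp only [List.forall_mem_cons, List.not_mem_nil, false_imp_iff, implies_true, and_true]
      exact ⟨huW₁, huW₂⟩
    · rw [hW₆]
      exact left_mem_sup_span_pair
    · rw [hW₆] at h
      have := form_eq_zero_of_mem_sup_span_pair (B := B) (z := a₂ - b₂)
        (fun e he => by simp [hE₃ e he, hE₄ e he]) (by simp [f₉, f₁₀, f₁₃, f₁₄])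
        (by simp [f₁₁, f₁₂, f₁₅, f₁₆]) h
      simp [hua₁, hub₁, f₉, f₁₀, f₁₂, f₁₃, f₁₄, f₁₆] at this
  have g₇ : IsIrredundantSeq G [W₁, W₂, W₆, W₇] := by
    -- In characteristic 2 the product of the elementary elements u, u', u interchanges a₁ with a₂
    -- and b₁ with b₂. This preserves the graph of the identity and moves W₇.
    have hw : ∀ v, (u * u' * u).1 v = u.1 (u'.1 (u.1 v)) := fun v => rfl
    have hdbl : ∀ v : V, v + v = 0 := fun v => by
      nth_rewrite 2 [← hneg v]
      exact add_neg_cancel v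
    have hwa₁ : (u * u' * u).1 a₁ = a₂ := by
      rw [hw, hua₁, hua₁', map_add, hua₁, hua₂, add_left_comm, hdbl, add_zero]
    have hwa₂ : (u * u' * u).1 a₂ = a₁ := by
      rw [hw, hua₂, map_add, hua₁', hua₂', add_left_comm, hdbl, add_zero, hua₁]
    have hwb₁ : (u * u' * u).1 b₁ = b₂ := by
      rw [hw, hub₁, map_add, hub₁', hub₂', add_left_comm, hdbl, add_zero, hub₂]
    have hwb₂ : (u * u' * u).1 b₂ = b₁ := by
      rw [hw, hub₂, hub₂', map_add, hub₁, hub₂, add_left_comm, hdbl, add_zero]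
    have hwE : ∀ e ∈ E, (u * u' * u).1 e = e := fun e he => by
      rw [hw, huE e he, huE' e he, huE e he]
    refine irredundantSeq_append_singleton_of_specialUnitary hG (l := [W₁, W₂, W₆]) g₆
      (u * u' * u) ?_ ⟨a₂ + b₁, ?_, fun h => ?_⟩
    · simp only [List.forall_mem_cons, List.not_mem_nil, false_imp_iff, implies_true, and_true,
        hW₁, hW₂, hW₆]
      refine ⟨map_mem_sup_span_pair hwE ?_ ?_, map_mem_sup_span_pair hwE ?_ ?_,
        map_mem_sup_span_pair hwE ?_ ?_⟩ <;>
      simp only [map_add, hwa₁, hwa₂, hwb₁, hwb₂] <;>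
      first | exact left_mem_sup_span_pair | exact right_mem_sup_span_pair
    · rw [hW₇]
      exact right_mem_sup_span_pair
    · rw [hW₇] at h
      have := form_eq_zero_of_mem_sup_span_pair (B := B) (z := a₁ - b₁ - b₂)
        (fun e he => by simp [hE₁ e he, hE₂ e he, hE₄ e he])
        (by simp [f₁, f₂, f₄, f₅, f₆, f₈, f₁₃, f₁₄, f₁₆])
        (by simp [f₂, f₃, f₆, f₇, f₁₄, f₁₅]) h
      rw [map_add, hwa₂, hwb₁] at this
      simp [f₁, f₄, f₅, f₈, f₁₃, f₁₆] at this
  refine not_isIBIS_of_irredundantSeq (eq_one_of_forall_smul_eq hτ hB hB' (by omega) hd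
    (by omega) G) g₅ g₇ (seqStabilizer_eq_of_fixes G fun g => ?_) (by simp)
  clear g₁ g₂ g₃ g₄ g₅ g₆ g₇ huW₁ huW₁' huW₂ huW₂' huE huE' hua₁ hua₂ hub₁ hub₂ hua₁' hua₂' hub₁'
    hub₂'
  simp only [List.forall_mem_cons, List.not_mem_nil, false_imp_iff, implies_true, and_true, hW₁,
    hW₂, hW₃, hW₄, hW₅, hW₆, hW₇]
  obtain ⟨σ, c, hg⟩ := g.2
  -- Once W₁ and W₂ are fixed, g acts on the frame modulo E through one 2 × 2 matrix on the a's and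
  -- one on the b's.
  have hcoord : GammaU.Fixes g (E ⊔ span K {a₁, a₂}) → GammaU.Fixes g (E ⊔ span K {b₁, b₂}) →
      (∀ v, v = a₁ ∨ v = a₂ → B a₁ (g.1 v) = 0 ∧ B a₂ (g.1 v) = 0 ∧
        ∃ e ∈ E, g.1 v = e + (B b₁ (g.1 v) • a₁ + B b₂ (g.1 v) • a₂)) ∧
      (∀ v, v = b₁ ∨ v = b₂ → B b₁ (g.1 v) = 0 ∧ B b₂ (g.1 v) = 0 ∧
        ∃ e ∈ E, g.1 v = e + (B a₁ (g.1 v) • b₁ + B a₂ (g.1 v) • b₂)) := by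
    intro h h'
    constructor
    · intro v hv
      have h3 := h v (by
        rcases hv with rfl | rfl
        exacts [left_mem_sup_span_pair, right_mem_sup_span_pair])
      exact ⟨form_eq_zero_of_mem_sup_span_pair hE₁ f₁ f₃ h3,
        form_eq_zero_of_mem_sup_span_pair hE₃ f₉ f₁₁ h3, d₁.mem_iff.1 h3⟩
    · intro v hv
      have h3 := h' v (by
        rcases hv with rfl | rfl
        exacts [left_mem_sup_span_pair, right_mem_sup_span_pair])
      exact ⟨form_eq_zero_of_mem_sup_span_pair hE₂ f₆ f₈ h3,
        form_eq_zero_of_mem_sup_span_pair hE₄ f₁₄ f₁₆ h3, d₂.mem_iff.1 h3⟩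
  constructor
  · rintro ⟨h₁, h₂, h₃, h₄, h₅⟩
    obtain ⟨hA, hA'⟩ := hcoord h₁ h₂
    obtain ⟨p₁, p₂, e₁, he₁, p₃⟩ := hA a₁ (Or.inl rfl)
    obtain ⟨q₁, q₂, e₂, he₂, q₃⟩ := hA a₂ (Or.inr rfl)
    obtain ⟨r₁, r₂, e₃, he₃, r₃⟩ := hA' b₁ (Or.inl rfl)
    obtain ⟨s₁, s₂, e₄, he₄, s₃⟩ := hA' b₂ (Or.inr rfl)
    have hgE := map_mem_of_fixes_opposite hF hE h₁ h₂
    -- Pairing with vectors orthogonal to W₃ and W₄ makes both matrices diagonal and equal; W₅ then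
    -- makes the diagonal entries equal.
    have k₁ := form_eq_zero_of_mem_sup_span_pair (B := B) (z := a₁ - b₁)
        (fun e he => by simp [hE₁ e he, hE₂ e he]) (by simp [f₁, f₂, f₅, f₆])
        (by simp [f₃, f₇]) (h₃ _ left_mem_sup_span_pair)
    have k₂ := form_eq_zero_of_mem_sup_span_pair hE₃ (by simp [f₉, f₁₀]) f₁₁
      (h₃ _ left_mem_sup_span_pair)
    have k₃ := form_eq_zero_of_mem_sup_span_pair (B := B) (z := a₁ - b₁)
        (fun e he => by simp [hE₁ e he, hE₂ e he]) (by simp [f₁, f₂, f₅, f₆])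
        (by simp [f₃, f₇]) (h₃ _ right_mem_sup_span_pair)
    have k₄ := form_eq_zero_of_mem_sup_span_pair (B := B) (z := a₂ - b₂)
        (fun e he => by simp [hE₃ e he, hE₄ e he]) (by simp [f₉, f₁₃])
        (by simp [f₁₁, f₁₂, f₁₅, f₁₆]) (h₄ _ right_mem_sup_span_pair)
    have k₅ := form_eq_zero_of_mem_sup_span_pair hE₁ f₁ (by simp [f₃, f₄])
      (h₄ _ right_mem_sup_span_pair)
    have k₆ := form_eq_zero_of_mem_sup_span_pair (B := B) (z := a₂ - b₂)
        (fun e he => by simp [hE₃ e he, hE₄ e he]) (by simp [f₉, f₁₃])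
        (by simp [f₁₁, f₁₂, f₁₅, f₁₆]) (h₄ _ left_mem_sup_span_pair)
    have k₇ := form_eq_zero_of_mem_sup_span_pair (B := B) (z := a₁ - a₂)
        (fun e he => by simp [hE₁ e he, hE₃ e he])
        (by simp [f₁, f₂, f₄, f₉, f₁₀, f₁₂]) (by simp [f₃, f₂, f₄, f₁₁, f₁₀, f₁₂])
        (h₅ _ left_mem_sup_span_pair)
    simp only [hg.map_add, map_add, map_sub, LinearMap.sub_apply, p₁, p₂, q₁, q₂, r₁, s₂,
      zero_add, zero_sub, sub_zero, neg_eq_zero] at k₁ k₂ k₃ k₄ k₅ k₆ k₇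
    replace k₇ : B a₁ (g.1 b₁) = B a₂ (g.1 b₂) := by linear_combination k₇ - k₅ + k₂
    rw [k₅] at s₃
    rw [k₂] at r₃
    rw [k₃] at q₃
    rw [k₆] at p₃
    rw [← k₇] at s₃
    rw [show B b₂ (g.1 a₂) = B a₁ (g.1 b₁) by linear_combination -k₇ - k₄] at q₃
    rw [show B b₁ (g.1 a₁) = B a₁ (g.1 b₁) by linear_combination -k₁] at p₃
    simp only [zero_smul, add_zero, zero_add] at p₃ q₃ r₃ s₃
    have t₁ : ActsAs g E (B a₁ (g.1 b₁)) a₁ := ⟨e₁, he₁, p₃⟩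
    have t₂ : ActsAs g E (B a₁ (g.1 b₁)) a₂ := ⟨e₂, he₂, q₃⟩
    have t₃ : ActsAs g E (B a₁ (g.1 b₁)) b₁ := ⟨e₃, he₃, r₃⟩
    have t₄ : ActsAs g E (B a₁ (g.1 b₁)) b₂ := ⟨e₄, he₄, s₃⟩
    exact ⟨h₁, h₂, ActsAs.fixes hgE (t₁.add t₃) (t₂.add t₄), ActsAs.fixes hgE ((t₁.add t₃).add t₄) (t₂.add t₃)⟩
  · rintro ⟨h₁, h₂, h₆, h₇⟩
    obtain ⟨hA, hA'⟩ := hcoord h₁ h₂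
    obtain ⟨p₁, p₂, e₁, he₁, p₃⟩ := hA a₁ (Or.inl rfl)
    obtain ⟨q₁, q₂, e₂, he₂, q₃⟩ := hA a₂ (Or.inr rfl)
    obtain ⟨r₁, r₂, e₃, he₃, r₃⟩ := hA' b₁ (Or.inl rfl)
    obtain ⟨s₁, s₂, e₄, he₄, s₃⟩ := hA' b₂ (Or.inr rfl)
    have hgE := map_mem_of_fixes_opposite hF hE h₁ h₂
    have z₁ : ∀ v ∈ E ⊔ span K {a₁ + b₁, a₂ + b₂}, B (a₁ - b₁) v = 0 := fun v =>
      form_eq_zero_of_mem_sup_span_pair (B := B) (fun e he => by simp [hE₁ e he, hE₂ e he])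
        (by simp [f₁, f₂, f₅, f₆]) (by simp [f₃, f₄, f₇, f₈])
    have z₂ : ∀ v ∈ E ⊔ span K {a₁ + b₁, a₂ + b₂}, B (a₂ - b₂) v = 0 := fun v =>
      form_eq_zero_of_mem_sup_span_pair (B := B) (fun e he => by simp [hE₃ e he, hE₄ e he])
        (by simp [f₉, f₁₀, f₁₃, f₁₄]) (by simp [f₁₁, f₁₂, f₁₅, f₁₆])
    have z₃ : ∀ v ∈ E ⊔ span K {a₁ + b₁ + b₂, a₂ + b₁}, B (a₁ - b₁ - b₂) v = 0 := fun v =>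
      form_eq_zero_of_mem_sup_span_pair (B := B) (fun e he => by simp [hE₁ e he, hE₂ e he, hE₄ e he])
        (by simp [f₁, f₂, f₄, f₅, f₆, f₈, f₁₃, f₁₄, f₁₆])
        (by simp [f₂, f₃, f₆, f₇, f₁₄, f₁₅])
    have z₄ : ∀ v ∈ E ⊔ span K {a₁ + b₁ + b₂, a₂ + b₁}, B (a₂ - b₁) v = 0 := fun v =>
      form_eq_zero_of_mem_sup_span_pair (B := B) (fun e he => by simp [hE₃ e he, hE₂ e he])
        (by simp [f₉, f₁₀, f₁₂, f₅, f₆, f₈]) (by simp [f₁₁, f₁₀, f₇, f₆])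
    have k₁ := z₁ _ (h₆ _ left_mem_sup_span_pair)
    have k₂ := z₂ _ (h₆ _ left_mem_sup_span_pair)
    have k₃ := z₁ _ (h₆ _ right_mem_sup_span_pair)
    have k₄ := z₂ _ (h₆ _ right_mem_sup_span_pair)
    have k₅ := z₄ _ (h₇ _ left_mem_sup_span_pair)
    have k₆ := z₃ _ (h₇ _ right_mem_sup_span_pair)
    have k₇ := hg.map_form a₁ b₁
    have k₈ := hg.map_form a₁ b₂
    have hb : ∀ v ∈ E ⊔ span K {b₁, b₂}, B e₁ v = 0 := fun v =>
      form_eq_zero_of_mem_sup_span_pair (hs e₁ he₁) (by rw [← hB.eq, hE₂ e₁ he₁, map_zero])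
        (by rw [← hB.eq, hE₄ e₁ he₁, map_zero])
    rw [p₃, f₂] at k₇
    rw [p₃, f₄] at k₈
    simp only [map_add, map_smulₛₗ, LinearMap.add_apply, LinearMap.smul_apply, smul_eq_mul,
      hb _ (h₂ _ left_mem_sup_span_pair), hb _ (h₂ _ right_mem_sup_span_pair), map_one, map_zero,
      mul_one, mul_zero, zero_add] at k₇ k₈
    simp only [hg.map_add, map_add, map_sub, LinearMap.sub_apply, p₁, p₂, q₁, q₂, r₁, r₂, s₁,
      s₂] at k₁ k₂ k₃ k₄ k₅ k₆
    have l₁ : B a₁ (g.1 b₁) = B b₁ (g.1 a₁) := by linear_combination k₁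
    have l₂ : B a₂ (g.1 b₁) = B b₂ (g.1 a₁) := by linear_combination k₂
    have l₃ : B a₁ (g.1 b₂) = B b₁ (g.1 a₂) := by linear_combination k₃
    have l₄ : B a₂ (g.1 b₂) = B b₂ (g.1 a₂) := by linear_combination k₄
    have l₅ : B b₂ (g.1 a₁) + B b₂ (g.1 a₂) = B b₁ (g.1 a₁) := by
      linear_combination k₅ - k₂ - k₄
    have l₆ : B b₁ (g.1 a₂) = B b₂ (g.1 a₁) := by linear_combination k₁ - k₆ - l₅
    rw [l₁, l₂] at k₇ r₃
    rw [l₃, l₄, l₆] at k₈ s₃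
    rw [l₆] at q₃
    -- W₆ and W₇ reduce both matrices to [[X, Y], [Y, X - Y]]. Preservation of the form gives N(X) +
    -- N(Y) = c ≠ 0. If Y ≠ 0, then X ≠ 0 would give 1 + 1 = 0, while X = 0 and the orthogonality
    -- relation `k₈` force Y = 0.
    have hY : B b₂ (g.1 a₁) = 0 := by
      by_contra hY
      have hX : B b₁ (g.1 a₁) = 0 := by
        by_contra hX
        exact hg.ne_zero (by rw [← k₇, hn _ hX, hn _ hY, h2])
      rw [hX, map_zero, zero_mul, zero_add, mul_eq_zero, map_eq_zero] at k₈
      exact hY (by rw [k₈.resolve_left hY, hX, add_zero] at l₅; exact l₅)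
    rw [hY, zero_add] at l₅
    rw [hY] at p₃ q₃ r₃ s₃
    rw [l₅] at q₃ s₃
    simp only [zero_smul, add_zero, zero_add] at p₃ q₃ r₃ s₃
    have t₁ : ActsAs g E (B b₁ (g.1 a₁)) a₁ := ⟨e₁, he₁, p₃⟩
    have t₂ : ActsAs g E (B b₁ (g.1 a₁)) a₂ := ⟨e₂, he₂, q₃⟩
    have t₃ : ActsAs g E (B b₁ (g.1 a₁)) b₁ := ⟨e₃, he₃, r₃⟩
    have t₄ : ActsAs g E (B b₁ (g.1 a₁)) b₂ := ⟨e₄, he₄, s₃⟩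
    exact ⟨h₁, h₂, ActsAs.fixes hgE (t₁.add t₃) t₂, ActsAs.fixes hgE t₁ (t₂.add t₄),
      ActsAs.fixes hgE ((t₁.add t₃).add t₄) ((t₂.add t₃).add t₄)⟩

end LinesOverF4

/-! ### One point is never a base. -/

section BaseSize

open Module

variable {K V : Type*} [Field K] [AddCommGroup V] [Module K V] {τ : K →+* K}
  {B : V →ₛₗ[τ] V →ₗ[K] K}

/-- The stabilizer of a totally singular `k`-space contains a nontrivial transvection. -/
theorem exists_ne_one_smul_eq [Finite V] [FiniteDimensional K V] (hτ : IsFiniteConj τ)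
    (hB : B.IsSymm) (hB' : B.Nondegenerate) {G : Subgroup (PGammaU B)} (hG : PSU B ≤ G)
    {k : ℕ} (hk : 1 ≤ k) (W : TotallySingular B k) : ∃ g : G, g ≠ 1 ∧ g • W = W := by
  obtain ⟨a, ha0⟩ : ∃ a : W.1, a ≠ 0 := by
    have : Nontrivial W.1 := Module.nontrivial_of_finrank_pos (R := K) (by rw [W.2.1]; omega)
    exact exists_ne 0
  have ha := W.2.2 a a.2 a a.2
  obtain ⟨t, ht0, ht⟩ := hτ.exists_skew
  obtain ⟨u, hu⟩ := exists_specialUnitary_transvection hB ha ht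
  refine ⟨⟨_, hG (PSU_mk_mem u)⟩, fun h => ?_, ?_⟩
  · have h1 := (QuotientGroup.eq_one_iff _).1 (congrArg Subtype.val h)
    obtain ⟨x, hx⟩ := h1
    replace hx : ∀ v, v + (t * B a v) • (a : V) = (x : K) • v := fun v => by
      rw [← hu]
      exact hx v
    have ha0' : (a : V) ≠ 0 := by simpa using ha0
    obtain ⟨v, hv⟩ : ∃ v, B a v ≠ 0 := by
      by_contra! h0
      exact ha0' (hB'.1 _ h0)
    have hx1 : (1 : K) = x := by
      have := hx a
      rw [ha, mul_zero, zero_smul, add_zero] at this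
      nth_rewrite 1 [← one_smul K (a : V)] at this
      exact smul_left_injective K ha0' this
    have := hx v
    rw [← hx1, one_smul, add_eq_left, smul_eq_zero] at this
    exact this.elim (mul_ne_zero ht0 hv) ha0'
  · rw [Subgroup.smul_def, smul_eq_self_iff]
    intro v hv
    change u.1 v ∈ W.1
    rw [hu, W.2.2 a a.2 v hv, mul_zero, zero_smul, add_zero]
    exact hv

theorem nonempty_totallySingular [FiniteDimensional K V] (hτ : IsFiniteConj τ)
    (hB : B.IsSymm) {k : ℕ} (hkd : 2 * k ≤ finrank K V) : Nonempty (TotallySingular B k) := by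
  obtain ⟨W, -, -, h, h'⟩ := exists_totallySingular_extension hτ hB (P := ⊤) (W₀ := ⊥) k
    (by rwa [finrank_top]) bot_le (by simp) (by simp)
  exact ⟨⟨W, h, h'⟩⟩

end BaseSize

/-! ### The unitary plane over the field with four elements. -/

section PlaneOverF4

open Module

variable {K V : Type*} [Field K] [AddCommGroup V] [Module K V] {τ : K →+* K}
  {B : V →ₛₗ[τ] V →ₗ[K] K} {a b w : V}

/-- A nonzero remainder would be orthogonal to a, b, w and so give four independent vectors. -/
theorem eq_expansion_of_finrank_le_three [FiniteDimensional K V] (hB : B.IsSymm)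
    (hd : finrank K V ≤ 3) (ha : B a a = 0) (hb : B b b = 0) (hab : B a b = 1)
    (hw : w ∈ perpPair B a b) (hww : B w w = 1) (v : V) :
    v = B b v • a + B a v • b + B w v • w := by
  have hba : B b a = 1 := by rw [← hB.eq, hab, map_one]
  obtain ⟨haw, hbw⟩ := mem_perpPair.1 hw
  have hwa : B w a = 0 := by rw [← hB.eq, haw, map_zero]
  have hwb : B w b = 0 := by rw [← hB.eq, hbw, map_zero]
  rw [← sub_eq_zero]
  by_contra hr
  set r := v - (B b v • a + B a v • b + B w v • w) with hrdef
  have h1 : B a r = 0 := by simp [hrdef, ha, hab, haw]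
  have h2 : B b r = 0 := by simp [hrdef, hb, hba, hbw]
  have h3 : B w r = 0 := by simp [hrdef, hww, hwa, hwb]
  have hli : LinearIndependent K ![a, b, w, r] := by
    rw [Fintype.linearIndependent_iff]
    intro s hs
    simp only [Fin.sum_univ_four, Matrix.cons_val_zero, Matrix.cons_val_one, Matrix.cons_val] at hs
    have e1 : s 1 = 0 := by simpa [ha, hab, haw, h1] using congrArg (B a) hs
    have e0 : s 0 = 0 := by simpa [hb, hba, hbw, h2] using congrArg (B b) hs
    have e2 : s 2 = 0 := by simpa [hww, hwa, hwb, h3] using congrArg (B w) hs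
    have e3 : s 3 = 0 := by simpa [e0, e1, e2, hr] using hs
    intro i
    fin_cases i
    exacts [e0, e1, e2, e3]
  have := hli.fintype_card_le_finrank
  rw [Fintype.card_fin] at this
  omega

/-- For `q = 2` the special unitary group of a plane is transitive on hyperbolic pairs. -/
theorem exists_specialUnitary_map_pair [FiniteDimensional K V] (hτ : IsFiniteConj τ)
    (hB : B.IsSymm) (hB' : B.Nondegenerate) (hd : finrank K V = 3)
    (hn : ∀ x : K, x ≠ 0 → τ x * x = 1) (ha : B a a = 0) (hb : B b b = 0) (hab : B a b = 1)
    {a' b' : V} (ha' : B a' a' = 0) (hb' : B b' b' = 0) (hab' : B a' b' = 1) :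
    ∃ u : SpecialUnitary B, u.1 a = a' ∧ u.1 b = b' := by
  have hba : B b a = 1 := by rw [← hB.eq, hab, map_one]
  have hba' : B b' a' = 1 := by rw [← hB.eq, hab', map_one]
  obtain ⟨w, hw, hww⟩ := exists_perpPair_form_eq hτ hB hB' hd.ge ha hb hab (map_one τ)
  obtain ⟨w', hw', hww'⟩ := exists_perpPair_form_eq hτ hB hB' hd.ge ha' hb' hab' (map_one τ)
  have hexp := eq_expansion_of_finrank_le_three hB hd.le ha hb hab hw hww
  obtain ⟨haw, hbw⟩ := mem_perpPair.1 hw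
  obtain ⟨haw', hbw'⟩ := mem_perpPair.1 hw'
  have hwa : B w a = 0 := by rw [← hB.eq, haw, map_zero]
  have hwb : B w b = 0 := by rw [← hB.eq, hbw, map_zero]
  have hwa' : B w' a' = 0 := by rw [← hB.eq, haw', map_zero]
  have hwb' : B w' b' = 0 := by rw [← hB.eq, hbw', map_zero]
  let φ : V →ₗ[K] V := (B b).smulRight a' + (B a).smulRight b' + (B w).smulRight w'
  have hφ : ∀ v, φ v = B b v • a' + B a v • b' + B w v • w' := fun v => rfl
  have hisom : ∀ v z, B (φ v) (φ z) = B v z := by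
    intro v z
    conv_rhs => rw [hexp v, hexp z]
    rw [hφ, hφ]
    simp only [map_add, map_smul, map_smulₛₗ, LinearMap.add_apply, LinearMap.smul_apply, ha, hb,
      hab, hba, haw, hbw, hwa, hwb, hww, ha', hb', hab', hba', haw', hbw', hwa', hwb', hww']
  have hinj : Function.Injective φ := by
    rw [injective_iff_map_eq_zero]
    intro v hv
    refine hB'.1 v fun z => ?_
    rw [← hisom, hv, map_zero, LinearMap.zero_apply]
  have hdet : LinearMap.det φ ≠ 0 :=
    (LinearEquiv.isUnit_det' (LinearEquiv.ofInjectiveEndo φ hinj)).ne_zero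
  -- For q = 2 the inverse of det φ automatically has norm one. The reflection in w' by this scalar
  -- corrects the determinant and fixes a' and b'.
  obtain ⟨u, hu⟩ := ((isIsometryDet_reflection hB (w := w') (by rw [hww']; exact one_ne_zero)
    (hn _ (inv_ne_zero hdet))).comp ⟨hisom, rfl⟩).exists_specialUnitary (inv_mul_cancel₀ hdet)
  refine ⟨u, ?_, ?_⟩
  · rw [hu, LinearMap.comp_apply, hφ, ha, hba, hwa]
    simp [LinearMap.transvection.apply, hwa']
  · rw [hu, LinearMap.comp_apply, hφ, hb, hab, hwb]
    simp [LinearMap.transvection.apply, hwb']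

theorem exists_span_eq_of_totallySingular (P : TotallySingular B 1) :
    ∃ a, a ≠ 0 ∧ B a a = 0 ∧ P.1 = K ∙ a := by
  have : FiniteDimensional K P.1 := Module.finite_of_finrank_pos (by rw [P.2.1]; exact one_pos)
  obtain ⟨a, ha0⟩ : ∃ a : P.1, a ≠ 0 := by
    have : Nontrivial P.1 := Module.nontrivial_of_finrank_pos (R := K) (by rw [P.2.1]; exact one_pos)
    exact exists_ne 0
  have ha0' : (a : V) ≠ 0 := by simpa using ha0
  refine ⟨a, ha0', P.2.2 a a.2 a a.2, ?_⟩
  exact (Submodule.eq_of_le_of_finrank_eq ((Submodule.span_singleton_le_iff_mem _ _).2 a.2)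
    (by rw [P.2.1, finrank_span_singleton ha0'])).symm

/-- Two singular points of a unitary plane span a hyperbolic line. -/
theorem exists_hyperbolic_pair_of_ne [FiniteDimensional K V] (hτ : IsFiniteConj τ)
    (hB : B.IsSymm) (hB' : B.Nondegenerate) (hd : finrank K V = 3) {P Q : TotallySingular B 1}
    (hPQ : P ≠ Q) :
    ∃ a b, B a a = 0 ∧ B b b = 0 ∧ B a b = 1 ∧ P.1 = K ∙ a ∧ Q.1 = K ∙ b := by
  obtain ⟨a, ha0, ha, hP⟩ := exists_span_eq_of_totallySingular P
  obtain ⟨b, hb0, hb, hQ⟩ := exists_span_eq_of_totallySingular Q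
  have hab : B a b ≠ 0 := by
    -- A plane has no totally singular line: b orthogonal to a has no c-coordinate in the expansion
    -- by a, c, w, and being singular it has no w-coordinate either.
    intro hab
    obtain ⟨v, hv⟩ : ∃ v, B a v ≠ 0 := by
      by_contra! h0
      exact ha0 (hB'.1 _ h0)
    obtain ⟨c, -, hc, hac⟩ := exists_hyperbolic_partner hτ hB (P := ⊤) trivial trivial ha hv
    obtain ⟨w, hw, hww⟩ := exists_perpPair_form_eq hτ hB hB' hd.ge ha hc hac (map_one τ)
    have hexp := eq_expansion_of_finrank_le_three hB hd.le ha hc hac hw hww b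
    rw [hab, zero_smul, add_zero] at hexp
    have haw := (mem_perpPair.1 hw).1
    have hwa : B w a = 0 := by rw [← hB.eq, haw, map_zero]
    have hwb : B w b = 0 := by
      have h := hb
      rw [hexp] at h
      simpa [ha, haw, hwa, hww] using h
    rw [hwb, zero_smul, add_zero] at hexp
    refine hPQ (Subtype.ext ?_)
    rw [hP, hQ, hexp]
    refine (Submodule.span_singleton_smul_eq (IsUnit.mk0 _ ?_) a).symm
    intro h0
    rw [h0, zero_smul] at hexp
    exact hb0 hexp
  refine ⟨a, (B a b)⁻¹ • b, ha, by simp [hb], by simp [hab], hP, ?_⟩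
  rw [hQ]
  exact (Submodule.span_singleton_smul_eq (IsUnit.mk0 _ (inv_ne_zero hab)) b).symm

/-- For `q = 2`, fixing the two points of a hyperbolic pair means multiplying them by the same
scalar. -/
theorem exists_common_smul (hB : B.IsSymm) (hn : ∀ x : K, x ≠ 0 → τ x * x = 1)
    (h2 : (1 : K) + 1 = 0) (hab : B a b = 1) {g : GammaU B} (hga : GammaU.Fixes g (K ∙ a))
    (hgb : GammaU.Fixes g (K ∙ b)) : ∃ r : K, r ≠ 0 ∧ g.1 a = r • a ∧ g.1 b = r • b := by
  have hba : B b a = 1 := by rw [← hB.eq, hab, map_one]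
  obtain ⟨σ, e, hg⟩ := g.2
  obtain ⟨r, hr⟩ := fixes_span_singleton.1 hga
  obtain ⟨s, hs⟩ := fixes_span_singleton.1 hgb
  have e1 := hg.map_form a b
  have e2 := hg.map_form b a
  rw [hr, hs] at e1 e2
  simp only [map_smulₛₗ, LinearMap.smul_apply, hab, hba, smul_eq_mul, mul_one, map_one,
    RingHom.id_apply] at e1 e2
  have hr0 : r ≠ 0 := by
    rintro rfl
    exact hg.ne_zero (by rw [← e2, zero_mul])
  have hs0 : s ≠ 0 := by
    rintro rfl
    exact hg.ne_zero (by rw [← e1, zero_mul])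
  -- The form gives τ r · s = τ s · r; as inverses are conjugates, r² = s², and in characteristic 2
  -- this means r = s.
  have h3 : (r + s) * (r + s) = 0 := by
    linear_combination r * s * (e1 - e2) - s ^ 2 * hn r hr0 + r ^ 2 * hn s hs0 + (r ^ 2 + r * s) * h2
  have h4 : s = r := by linear_combination mul_self_eq_zero.1 h3 - r * h2
  exact ⟨r, hr0, hr, by rw [hs, h4]⟩

/-- For `q = 2`, a semisimilarity of a unitary plane that fixes two points of a hyperbolic line
fixes the third singular point of this line; if it fixes a singular point off this line as well,
then it is a scalar. -/
theorem fixes_or_mem_scalarSubgroup [FiniteDimensional K V] (hτ : IsFiniteConj τ)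
    (hB : B.IsSymm) (hB' : B.Nondegenerate) (hd : finrank K V = 3) (hcard : Nat.card K = 4)
    (hn : ∀ x : K, x ≠ 0 → τ x * x = 1) (h2 : (1 : K) + 1 = 0) {P Q R : TotallySingular B 1}
    (hPQ : P ≠ Q) :
    (∀ g : GammaU B, GammaU.Fixes g P.1 → GammaU.Fixes g Q.1 → GammaU.Fixes g R.1) ∨
    ∀ g : GammaU B, GammaU.Fixes g P.1 → GammaU.Fixes g Q.1 → GammaU.Fixes g R.1 →
      g ∈ scalarSubgroup B := by
  obtain ⟨a, b, ha, hb, hab, hP, hQ⟩ := exists_hyperbolic_pair_of_ne hτ hB hB' hd hPQ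
  obtain ⟨c, hc0, hc, hR⟩ := exists_span_eq_of_totallySingular R
  have hba : B b a = 1 := by rw [← hB.eq, hab, map_one]
  obtain ⟨w, hw, hww⟩ := exists_perpPair_form_eq hτ hB hB' hd.ge ha hb hab (map_one τ)
  have hexp := eq_expansion_of_finrank_le_three hB hd.le ha hb hab hw hww
  obtain ⟨haw, hbw⟩ := mem_perpPair.1 hw
  have hwa : B w a = 0 := by rw [← hB.eq, haw, map_zero]
  have hwb : B w b = 0 := by rw [← hB.eq, hbw, map_zero]
  rw [hP, hQ, hR]
  obtain ⟨x, hx⟩ : ∃ x, x = B b c := ⟨_, rfl⟩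
  obtain ⟨y, hy⟩ : ∃ y, y = B a c := ⟨_, rfl⟩
  obtain ⟨z, hz⟩ : ∃ z, z = B w c := ⟨_, rfl⟩
  have hcx : c = x • a + y • b + z • w := by rw [hx, hy, hz]; exact hexp c
  have hform : τ x * y + τ y * x + τ z * z = 0 := by
    rw [hcx] at hc
    simp only [map_add, map_smul, map_smulₛₗ, LinearMap.add_apply, LinearMap.smul_apply, ha, hb,
      hab, hba, haw, hbw, hwa, hwb, hww, smul_eq_mul] at hc
    linear_combination hc
  by_cases hz0 : z = 0
  · left
    intro g hga hgb
    obtain ⟨r, hr0, hra, hrb⟩ := exists_common_smul hB hn h2 hab hga hgb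
    obtain ⟨σ, e, hg⟩ := g.2
    rw [hz0, zero_smul, add_zero] at hcx
    rw [fixes_span_singleton, hcx, hg.map_add, hg.map_smul, hg.map_smul, hra, hrb]
    by_cases hx0 : x = 0
    · have hy0 : y ≠ 0 := by
        rintro rfl
        exact hc0 (by rw [hcx, hx0, zero_smul, zero_smul, add_zero])
      refine ⟨σ y * r / y, ?_⟩
      rw [hx0, map_zero, zero_smul, zero_smul, zero_add, zero_add, smul_smul, smul_smul,
        div_mul_cancel₀ _ hy0]
    · refine ⟨σ x * r / x, ?_⟩
      rw [smul_add, smul_smul, smul_smul, smul_smul, smul_smul, div_mul_cancel₀ _ hx0]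
      by_cases hy0 : y = 0
      · rw [hy0, map_zero, zero_mul, mul_zero]
      · have h3 : (x + y) * (x + y) = 0 := by
          rw [hz0, mul_zero, add_zero] at hform
          linear_combination x * y * hform - y ^ 2 * hn x hx0 - x ^ 2 * hn y hy0 + x * y * h2
        have h4 : y = x := by linear_combination mul_self_eq_zero.1 h3 - x * h2
        rw [h4, div_mul_cancel₀ _ hx0]
  · right
    intro g hga hgb hgc
    obtain ⟨r, hr0, hra, hrb⟩ := exists_common_smul hB hn h2 hab hga hgb
    obtain ⟨n, hnc⟩ := fixes_span_singleton.1 hgc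
    obtain ⟨σ, e, hg⟩ := g.2
    rw [hn z hz0] at hform
    have hx0 : x ≠ 0 := by
      rintro rfl
      simp at hform
    have f1 := hg.form_eq_zero haw
    have f2 := hg.form_eq_zero hbw
    rw [hra, map_smulₛₗ, LinearMap.smul_apply, smul_eq_mul, mul_eq_zero, map_eq_zero] at f1
    rw [hrb, map_smulₛₗ, LinearMap.smul_apply, smul_eq_mul, mul_eq_zero, map_eq_zero] at f2
    replace f1 := f1.resolve_left hr0
    replace f2 := f2.resolve_left hr0
    rw [hcx, hg.map_add, hg.map_add, hg.map_smul, hg.map_smul, hg.map_smul, hra, hrb] at hnc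
    have e1 := congrArg (B b) hnc
    have e2 := congrArg (B a) hnc
    simp only [map_add, map_smul, ha, hb, hab, hba, haw, hbw, f1, f2, smul_eq_mul, mul_zero,
      mul_one, add_zero, zero_add] at e1 e2
    -- The ratio s is fixed by σ and has trace one, so it is neither 0 nor 1. Thus σ fixes 0, 1, s,
    -- 1 + s, which is the whole field.
    set s := y / x with hs
    have hσs : σ s = s := by
      rw [hs, map_div₀, div_eq_div_iff (by simpa using hx0) hx0]
      apply mul_right_cancel₀ hr0
      have hn0 : n ≠ 0 := by
        rintro rfl
        rw [zero_mul, mul_eq_zero] at e1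
        exact e1.elim (by simpa using hx0) hr0
      linear_combination x * e2 - y * e1
    have hτs : s + τ s = 1 := by
      rw [hs, map_div₀, div_add_div _ _ hx0 (by simpa using hx0), mul_comm x (τ x), hn x hx0,
        div_one]
      linear_combination hform - h2
    have hs0 : s ≠ 0 := by
      intro h
      simp [h] at hτs
    have hs1 : s ≠ 1 := by
      intro h
      rw [h, map_one, h2] at hτs
      exact zero_ne_one hτs
    have hσ : ∀ v, σ v = v := by
      intro v
      by_contra hv
      have := Nat.finite_of_card_ne_zero (α := K) (by rw [hcard]; norm_num)
      have := Fintype.ofFinite K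
      classical
      have h5 : ({0, 1, s, 1 + s, v} : Finset K).card ≤ 4 := by
        rw [← hcard, Nat.card_eq_fintype_card]
        exact Finset.card_le_univ _
      have hv0 : v ≠ 0 := by rintro rfl; simp at hv
      have hv1 : v ≠ 1 := by rintro rfl; simp at hv
      have hvs : v ≠ s := by rintro rfl; exact hv hσs
      have hvs1 : v ≠ 1 + s := by rintro rfl; exact hv (by rw [map_add, map_one, hσs])
      have h1s : 1 + s ≠ 0 := fun h => hs1 (by linear_combination h - h2)
      rw [Finset.card_insert_of_notMem, Finset.card_insert_of_notMem, Finset.card_insert_of_notMem,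
        Finset.card_insert_of_notMem, Finset.card_singleton] at h5
      · omega
      · simpa using hvs1.symm
      · simp [hvs.symm]
      · simp [hs0, hs1.symm, hv1.symm]
      · simp [hs0.symm, h1s.symm, hv0.symm]
    rw [hσ] at e1
    have hnr : n = r := mul_right_cancel₀ hx0 (by linear_combination -e1)
    have hgw : g.1 w = r • w := by
      rw [hσ, hσ, hσ, hnr] at hnc
      have h6 : z • g.1 w = z • r • w := by
        have : r • (x • a + y • b + z • w) = x • r • a + y • r • b + z • r • w := by module
        rw [this] at hnc
        exact add_left_cancel hnc
      exact smul_right_injective V hz0 h6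
    refine ⟨Units.mk0 r hr0, fun v => ?_⟩
    rw [hexp v, hg.map_add, hg.map_add, hg.map_smul, hg.map_smul, hg.map_smul, hσ, hσ, hσ, hra,
      hrb, hgw, Units.smul_mk0]
    module

end PlaneOverF4

/-! ### The IBIS property for (d, q) = (3, 2), and the final case distinction. -/

section Main

open Module

theorem IsIrredundantSeq.exists_smul_ne {G : Type*} [Group G] {Ω : Type*} [MulAction G Ω]
    {l l' : List Ω} {ω : Ω} (h : IsIrredundantSeq G (l ++ ω :: l')) :
    ∃ g ∈ seqStabilizer G l, g • ω ≠ ω := by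
  have h1 := h l.length (by simp)
  rw [List.take_left, show l ++ ω :: l' = (l ++ [ω]) ++ l' by simp,
    List.take_left' (by simp), seqStabilizer_append_singleton] at h1
  obtain ⟨g, hg, hg'⟩ := SetLike.exists_of_lt h1
  exact ⟨g, hg, fun h2 => hg' ⟨hg, h2⟩⟩

variable {K V : Type*} [Field K] [AddCommGroup V] [Module K V] {τ : K →+* K}
  {B : V →ₛₗ[τ] V →ₗ[K] K}

theorem smul_eq_of_span_eq [Finite V] {u : SpecialUnitary B} {P P' : TotallySingular B 1} {a a' : V}
    (hP : P.1 = K ∙ a) (hP' : P'.1 = K ∙ a') (h : u.1 a = a') :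
    (QuotientGroup.mk (SpecialUnitary.toGammaU B u) : PGammaU B) • P = P' := by
  refine Subtype.ext (SetLike.coe_injective ?_)
  rw [PGammaU.coe_mk_smul, hP, hP', ← h]
  ext v
  simp only [Set.mem_image, SetLike.mem_coe, Submodule.mem_span_singleton]
  constructor
  · rintro ⟨_, ⟨r, rfl⟩, rfl⟩
    exact ⟨r, (u.1.map_smul r a).symm⟩
  · rintro ⟨r, rfl⟩
    exact ⟨r • a, ⟨r, rfl⟩, u.1.map_smul r a⟩

/-- For `q = 2` the action on the singular points of a unitary plane is IBIS. -/
theorem isIBIS_points_of_card_eq_four [Finite V] [FiniteDimensional K V] (hτ : IsFiniteConj τ)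
    (hB : B.IsSymm) (hB' : B.Nondegenerate) (hd : finrank K V = 3) (hcard : Nat.card K = 4)
    (hn : ∀ x : K, x ≠ 0 → τ x * x = 1) (h2 : (1 : K) + 1 = 0) {G : Subgroup (PGammaU B)}
    (hG : PSU B ≤ G) : IsIBIS G (TotallySingular B 1) := by
  have hmk : ∀ g : GammaU B, ∀ P : TotallySingular B 1,
      (QuotientGroup.mk g : PGammaU B) • P = P ↔ GammaU.Fixes g P.1 := smul_eq_self_iff
  obtain ⟨P₀⟩ := nonempty_totallySingular (B := B) hτ hB (k := 1) (by omega)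
  have hform : ∀ l : List (TotallySingular B 1), IsIrredundantBase G l →
      ∃ P Q : TotallySingular B 1, P ≠ Q ∧ ((seqStabilizer G [P, Q] = ⊥ ∧ l.length = 2) ∨
        (seqStabilizer G [P, Q] ≠ ⊥ ∧ l.length = 3)) := by
    rintro l ⟨hb, hirr⟩
    match l, hb, hirr with
    | [], hb, _ =>
      obtain ⟨g, hg, -⟩ := exists_ne_one_smul_eq hτ hB hB' hG le_rfl P₀
      exact absurd ((Subgroup.eq_bot_iff_forall _).1 hb g (mem_seqStabilizer.2 (by simp))) hg
    | [P], hb, _ =>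
      obtain ⟨g, hg, hP⟩ := exists_ne_one_smul_eq hτ hB hB' hG le_rfl P
      exact absurd ((Subgroup.eq_bot_iff_forall _).1 hb g (mem_seqStabilizer.2 (by simpa))) hg
    | P :: Q :: l, hb, hirr =>
      refine ⟨P, Q, ?_, ?_⟩
      · rintro rfl
        obtain ⟨g, hg, hg'⟩ := hirr.exists_smul_ne (l := [P])
        exact hg' (mem_seqStabilizer.1 hg P (by simp))
      match l, hb, hirr with
      | [], hb, _ => exact Or.inl ⟨hb, rfl⟩
      | R :: l, hb, hirr =>
        right
        obtain ⟨⟨g, hgG⟩, hg, hgR⟩ := hirr.exists_smul_ne (l := [P, Q])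
        obtain ⟨g, rfl⟩ := QuotientGroup.mk_surjective g
        have hPQ : P ≠ Q := by
          rintro rfl
          obtain ⟨g, hg, hg'⟩ := hirr.exists_smul_ne (l := [P])
          exact hg' (mem_seqStabilizer.1 hg P (by simp))
        have hgP := mem_seqStabilizer.1 hg P (by simp)
        have hgQ := mem_seqStabilizer.1 hg Q (by simp)
        rw [Subgroup.smul_def, hmk] at hgP hgQ
        rw [Ne, Subgroup.smul_def, hmk] at hgR
        -- Some element fixes P and Q but moves R, which excludes the first alternative. Hence P, Q,
        -- R have trivial stabilizer and no fourth point can follow.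
        have hsc := (fixes_or_mem_scalarSubgroup hτ hB hB' hd hcard hn h2 (R := R)
          hPQ).resolve_left fun h => hgR (h g hgP hgQ)
        refine ⟨fun h0 => ?_, ?_⟩
        · rw [h0, Subgroup.mem_bot] at hg
          apply hgR
          rw [← hmk, show (QuotientGroup.mk g : PGammaU B) = 1 from congrArg Subtype.val hg,
            one_smul]
        · match l, hirr with
          | [], _ => rfl
          | S :: l, hirr =>
            exfalso
            obtain ⟨⟨g, hgG⟩, hg, hgS⟩ := hirr.exists_smul_ne (l := [P, Q, R])
            obtain ⟨g, rfl⟩ := QuotientGroup.mk_surjective g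
            have hgP := mem_seqStabilizer.1 hg P (by simp)
            have hgQ := mem_seqStabilizer.1 hg Q (by simp)
            have hgR := mem_seqStabilizer.1 hg R (by simp)
            rw [Subgroup.smul_def, hmk] at hgP hgQ hgR
            apply hgS
            rw [Subgroup.smul_def]
            change (QuotientGroup.mk g : PGammaU B) • S = S
            rw [(QuotientGroup.eq_one_iff g).2 (hsc g hgP hgQ hgR), one_smul]
  -- SU is transitive on pairs of distinct singular points, so all two-point stabilizers in G are
  -- conjugate.
  have htrans : ∀ P Q P' Q' : TotallySingular B 1, P ≠ Q → P' ≠ Q' →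
      seqStabilizer G [P, Q] = ⊥ → seqStabilizer G [P', Q'] = ⊥ := by
    intro P Q P' Q' hPQ hPQ' h
    obtain ⟨a, b, ha, hb, hab, hP, hQ⟩ := exists_hyperbolic_pair_of_ne hτ hB hB' hd hPQ
    obtain ⟨a', b', ha', hb', hab', hP', hQ'⟩ := exists_hyperbolic_pair_of_ne hτ hB hB' hd hPQ'
    obtain ⟨u, hua, hub⟩ := exists_specialUnitary_map_pair hτ hB hB' hd hn ha hb hab ha' hb' hab'
    let x : G := ⟨_, hG (PSU_mk_mem u)⟩
    have hxP : x • P = P' := smul_eq_of_span_eq hP hP' hua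
    have hxQ : x • Q = Q' := smul_eq_of_span_eq hQ hQ' hub
    refine (Subgroup.eq_bot_iff_forall _).2 fun g hg => ?_
    have h1 : x⁻¹ * g * x ∈ seqStabilizer G [P, Q] := by
      rw [mem_seqStabilizer] at hg ⊢
      simp only [List.forall_mem_cons, List.not_mem_nil, false_imp_iff, implies_true, and_true,
        ← hxP, ← hxQ] at hg ⊢
      simp only [mul_smul, hg, inv_smul_smul, and_self]
    rw [h, Subgroup.mem_bot] at h1
    simpa [mul_assoc, inv_mul_eq_iff_eq_mul] using h1
  intro l l' hl hl'
  obtain ⟨P, Q, hPQ, h⟩ := hform l hl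
  obtain ⟨P', Q', hPQ', h'⟩ := hform l' hl'
  rcases h with ⟨h, e⟩ | ⟨h, e⟩ <;> rcases h' with ⟨h', e'⟩ | ⟨h', e'⟩
  · rw [e, e']
  · exact absurd (htrans _ _ _ _ hPQ hPQ' h) h'
  · exact absurd (htrans _ _ _ _ hPQ' hPQ h') h
  · rw [e, e']

end Main

theorem proposition3p12
    (p f d k : ℕ) [Fact p.Prime] (hd : 3 ≤ d) (hk : 1 ≤ k) (hkd : 2 * k ≤ d)
    {K V : Type*} [Field K] [Finite K] [CharP K p] (hK : Nat.card K = (p ^ f) ^ 2)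
    [AddCommGroup V] [Module K V] (hV : Module.finrank K V = d)
    (B : V →ₛₗ[iterateFrobenius K p f] V →ₗ[K] K) (hB : B.IsSymm) (hB' : B.Nondegenerate)
    (G : Subgroup (PGammaU B)) (hG : PSU B ≤ G) :
    ((d, p ^ f) ≠ (3, 2) →
      ¬ IsIBIS G (TotallySingular B k) ∧ 2 ≤ baseSize G (TotallySingular B k)) ∧
    ((d, p ^ f) = (3, 2) → IsIBIS G (TotallySingular B k)) := by
  have hfd : FiniteDimensional K V := Module.finite_of_finrank_pos (by omega)
  have hfin : Finite V := Module.finite_of_finite K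
  have hτ := isFiniteConj_iterateFrobenius p f hK
  have htwo : p ^ f = 2 → Nat.card K = 4 ∧ (1 : K) + 1 = 0 ∧
      ∀ x : K, x ≠ 0 → iterateFrobenius K p f x * x = 1 := by
    intro hq
    have hcard : Nat.card K = 4 := by rw [hK, hq]; norm_num
    refine ⟨hcard, ?_, fun x hx => ?_⟩
    · have h1 : ((p ^ f : ℕ) : K) = 0 := by
        rw [Nat.cast_pow, CharP.cast_eq_zero, zero_pow]
        rintro rfl
        simp at hq
      rw [hq] at h1
      rw [one_add_one_eq_two]
      exact_mod_cast h1
    · have := Fintype.ofFinite K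
      have h1 := FiniteField.pow_card_sub_one_eq_one x hx
      rw [← Nat.card_eq_fintype_card, hcard] at h1
      rw [iterateFrobenius_def, hq, ← pow_succ]
      exact h1
  have hq2 : p ^ f ≠ 2 → 2 < p ^ f := by
    intro hq
    have h1 : 1 < Nat.card K := Finite.one_lt_card
    rw [hK] at h1
    by_contra! h2
    interval_cases p ^ f <;> omega
  constructor
  · intro hne
    refine ⟨?_, ?_⟩
    · rcases hk.eq_or_lt with rfl | hk2
      · rcases hd.eq_or_lt with rfl | hd4
        · have hq := hq2 fun h => hne (by rw [h])
          exact not_isIBIS_points_of_three_le hτ hB hB' hV.ge (exists_norm_ne_one p f hK hq)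
            (exists_norm_one_cube_ne p f hK hq) hG
        · exact not_isIBIS_points_of_four_le hτ hB hB' (by omega) hG
      · obtain ⟨j, rfl⟩ : ∃ j, k = j + 2 := ⟨k - 2, by omega⟩
        by_cases hq : p ^ f = 2
        · obtain ⟨-, h2, hn⟩ := htwo hq
          exact not_isIBIS_of_norm_eq_one hτ hB hB' (by omega) hn h2 hG
        · exact not_isIBIS_of_exists_norm_ne_one hτ hB hB' (by omega)
            (exists_norm_ne_one p f hK (hq2 hq)) hG
    · have hne1 := fun W => exists_ne_one_smul_eq hτ hB hB' hG hk W
      obtain ⟨W⟩ := nonempty_totallySingular hτ hB (k := k) (by omega)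
      obtain ⟨g, hg, -⟩ := hne1 W
      have : Finite (TotallySingular B k) := by
        unfold TotallySingular
        infer_instance
      exact two_le_baseSize (eq_one_of_forall_smul_eq hτ hB hB' hk (by omega) (by omega) G)
        ⟨g, hg⟩ hne1
  · intro he
    obtain ⟨rfl, hq⟩ := Prod.mk.inj he
    obtain rfl : k = 1 := by omega
    obtain ⟨hcard, h2, hn⟩ := htwo hq
    exact isIBIS_points_of_card_eq_four hτ hB hB' hV hcard hn h2 hG
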